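/- Let $\lambda>2$, let $P(z)=z^2-\lambda$, and let $\xi\ge 0$ be the non-negative fixed point of $P$, so $P(\xi)=\xi$. Put $\rho=2\xi=P'(\xi)$ and $\hat P(z)=P(z+\xi)-\xi$. For integers $l\ge1$ define heights $h(-l)\ge 0$ by $$-\xi\cosh(\pi h(-k))=P(0)\quad (k\ge1\text{ odd}),\qquad \xi\cosh(\pi h(-k2^m))=P^{\circ(m+1)}(0)\quad (k\ge1\text{ odd},\ m\ge1),$$ and let $$\Pi_F=\{x+iy: x<0,\ y>0\}\setminus\bigcup_{l\ge1}[-l,\,-l+ih(-l)],\qquad \mathbb C_+=\{w:\operatorname{Im}w>0\}.$$ (1) There is a unique entire function $F$ with $\hat P(F(z))=F(\rho z)$ for all $z\in\mathbb C$, $F(0)=0$ and $F'(0)=1$ (the Poincaré function). (2) There is a unique conformal (analytic and bijective) map $\Psi_F:\mathbb C_+\to\Pi_F$ such that $\Psi_F(0)=0$ and $\Psi_F(\infty)=\infty$ (that is, $\Psi_F(w)\to0$ as $w\to0$ and $\Psi_F(w)\to\infty$ as $w\to\infty$ in $\mathbb C_+$), and $$\frac{d}{dw}\bigl(\xi\cos(\pi\Psi_F(w))\bigr)\Big|_{w=0}=1$$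 (the derivative at the boundary point $0$ being taken within $\mathbb C_+$). (3) $F(\infty)=\infty$, in the sense that $F(w)\to\infty$ as $w\to\infty$ in every sector $\{w:\operatorname{Im}w\ge\varepsilon|w|\}$, $\varepsilon>0$; and $$F(w)+\xi=\xi\cos(\pi\Psi_F(w))\qquad\text{for all } w\in\mathbb C_+.$$ -/

import Mathlib

open Filter Topology

/-- The quadratic polynomial `P(z) = z ^ 2 - c`. -/
def quadP {R : Type*} [CommRing R] (c : R) (z : R) : R := z ^ 2 - c

/-- The conjugate `φ⁻¹ ∘ P ∘ φ` of `P(z) = z ^ 2 - c` by the translation `φ(z) = z + x`. -/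
def quadPHat {R : Type*} [CommRing R] (c x : R) (z : R) : R := quadP c (z + x) - x

/-- `F` is an entire solution of the Poincaré equation `P̂(F(z)) = F(ρ z)`, `ρ = 2 ξ`,
normalized by `F(0) = 0` and `F'(0) = 1`. -/
structure IsPoincareFunction (lam xi : ℝ) (F : ℂ → ℂ) : Prop where
  entire : Differentiable ℂ F
  equation : ∀ z : ℂ, quadPHat (lam : ℂ) (xi : ℂ) (F z) = F ((2 * xi : ℂ) * z)
  map_zero : F 0 = 0
  deriv_zero : HasDerivAt F 1 0

/-- The open upper half-plane, as a subset of `ℂ`. -/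
def upperHalf : Set ℂ := {w : ℂ | 0 < w.im}

/-- The height `h(-l)` of the slit at `-l`, for `l ≥ 1`. It is the nonnegative solution of
`-ξ cosh (π h(-k)) = P(0)` for `l = k` odd, and of `ξ cosh (π h(-k 2 ^ m)) = P^{∘(m+1)}(0)`
for `l = k 2 ^ m` with `k` odd and `m ≥ 1`; see `slitHeight_odd`, `slitHeight_even` and
`slitHeight_nonneg`. -/
noncomputable def slitHeight (lam xi : ℝ) (l : ℕ) : ℝ :=
  open Classical in
  if Odd l then Real.arcosh (-(quadP lam 0) / xi) / Real.pi
  else Real.arcosh ((quadP lam)^[padicValNat 2 l + 1] 0 / xi) / Real.pi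

theorem two_lt_fixedPoint {lam xi : ℝ} (hlam : 2 < lam) (hxi : 0 ≤ xi)
    (hfix : quadP lam xi = xi) : 2 < xi := by
  unfold quadP at hfix
  nlinarith

theorem one_le_odd_value {lam xi : ℝ} (hlam : 2 < lam) (hxi : 0 ≤ xi)
    (hfix : quadP lam xi = xi) : 1 ≤ -(quadP lam 0) / xi := by
  have h2 := two_lt_fixedPoint hlam hxi hfix
  rw [le_div_iff₀ (by linarith)]
  unfold quadP at *
  nlinarith

theorem one_le_even_value {lam xi : ℝ} (hlam : 2 < lam) (hxi : 0 ≤ xi)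
    (hfix : quadP lam xi = xi) {m : ℕ} (hm : 1 ≤ m) :
    1 ≤ (quadP lam)^[m + 1] 0 / xi := by
  have h2 := two_lt_fixedPoint hlam hxi hfix
  rw [le_div_iff₀ (by linarith), one_mul]
  induction m, hm using Nat.le_induction with
  | base =>
    simp only [Function.iterate_succ, Function.iterate_zero, Function.comp, id]
    unfold quadP at *
    nlinarith
  | succ m hm ih =>
    rw [Function.iterate_succ_apply']
    generalize (quadP lam)^[m + 1] 0 = x at ih
    unfold quadP at *
    nlinarith

theorem slitHeight_odd {lam xi : ℝ} (hlam : 2 < lam) (hxi : 0 ≤ xi)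
    (hfix : quadP lam xi = xi) {k : ℕ} (hk : Odd k) :
    -xi * Real.cosh (Real.pi * slitHeight lam xi k) = quadP lam 0 := by
  have h2 := two_lt_fixedPoint hlam hxi hfix
  rw [slitHeight, if_pos hk, mul_div_cancel₀ _ Real.pi_ne_zero,
    Real.cosh_arcosh (one_le_odd_value hlam hxi hfix)]
  field_simp

theorem slitHeight_even {lam xi : ℝ} (hlam : 2 < lam) (hxi : 0 ≤ xi)
    (hfix : quadP lam xi = xi) {k m : ℕ} (hk : Odd k) (hm : 1 ≤ m) :
    xi * Real.cosh (Real.pi * slitHeight lam xi (k * 2 ^ m)) = (quadP lam)^[m + 1] 0 := by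
  have h2 := two_lt_fixedPoint hlam hxi hfix
  have hodd : ¬ Odd (k * 2 ^ m) := by
    rw [Nat.not_odd_iff_even]
    exact ((even_two : Even 2).pow_of_ne_zero (by omega)).mul_left k
  have hval : padicValNat 2 (k * 2 ^ m) = m := by
    rw [padicValNat.mul (by rintro rfl; simp at hk) (by positivity), padicValNat.prime_pow,
      padicValNat.eq_zero_of_not_dvd (by rwa [← even_iff_two_dvd, Nat.not_even_iff_odd]), zero_add]
  rw [slitHeight, if_neg hodd, mul_div_cancel₀ _ Real.pi_ne_zero, hval,
    Real.cosh_arcosh (one_le_even_value hlam hxi hfix hm)]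
  field_simp

theorem slitHeight_nonneg {lam xi : ℝ} (hlam : 2 < lam) (hxi : 0 ≤ xi)
    (hfix : quadP lam xi = xi) {l : ℕ} (hl : 1 ≤ l) : 0 ≤ slitHeight lam xi l := by
  unfold slitHeight
  split_ifs with h
  · exact div_nonneg (Real.arcosh_nonneg (one_le_odd_value hlam hxi hfix)) Real.pi_pos.le
  · refine div_nonneg (Real.arcosh_nonneg (one_le_even_value hlam hxi hfix ?_)) Real.pi_pos.le
    exact one_le_padicValNat_of_dvd (by omega)
      (even_iff_two_dvd.mp (Nat.not_odd_iff_even.mp h))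

/-- The comb domain `Π_F`: the left upper quarter of the plane with the vertical slits
`[-l, -l + i h(-l)]`, `l ≥ 1`, removed. -/
noncomputable def combDomain (lam xi : ℝ) : Set ℂ :=
  {z : ℂ | z.re < 0 ∧ 0 < z.im} \
    ⋃ (l : ℕ) (_ : 1 ≤ l),
      segment ℝ (-(l : ℂ)) (-(l : ℂ) + Complex.I * (slitHeight lam xi l : ℂ))

/-- `Ψ` is a conformal (analytic and bijective) map of the upper half-plane onto `Π_F` with
`Ψ(0) = 0` and `Ψ(∞) = ∞` in the sense of boundary limits within the upper half-plane, and such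
that `ξ cos (π Ψ(w))` has derivative `1` at the boundary point `w = 0`.
Only the values of `Ψ` on the upper half-plane and at `0` matter. -/
structure IsNormalizedCombMap (lam xi : ℝ) (Ψ : ℂ → ℂ) : Prop where
  analytic : DifferentiableOn ℂ Ψ upperHalf
  bijective : Set.BijOn Ψ upperHalf (combDomain lam xi)
  map_zero : Ψ 0 = 0
  continuous_zero : ContinuousWithinAt Ψ upperHalf 0
  map_infty : Tendsto Ψ (Bornology.cobounded ℂ ⊓ 𝓟 upperHalf) (Bornology.cobounded ℂ)
  deriv_zero :
    HasDerivWithinAt (fun w : ℂ => (xi : ℂ) * Complex.cos ((Real.pi : ℂ) * Ψ w)) 1 upperHalf 0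

/-!
The comb map is constructed explicitly, from a lift of the polynomial `P` through `ξ cos`.

Put `ρ = 2 ξ` and `κ = √(ξ / 2) > 1`. If `S` satisfies `sin (S t) = κ sin t`, then `L = 2 S`
satisfies `ξ cos (L t) = P (ξ cos t)`. Such an `S` exists as a conformal map of the upper half-plane
into itself that commutes with the translation by `π`; it is given by a closed formula
(`sinScale`). Since the sine is injective modulo `2π` on the upper half-plane and maps it onto the
complement of `[-1, 1]`, the map `S` is injective and omits exactly the points where the sine takes
values in `[-κ, κ]` (`exists_sinScale_eq_iff`). In terms of `L` the omitted set consists of the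
slits at the odd multiples of `π`, and the recursion of the heights says that `L` carries the slit
at `-j π` to the slit at `-2 j π`. So the comb, dilated by `π`, is completely invariant under `L`
and contained in its image (`combStep_mem_scaledComb_iff`, `exists_combStep_eq`).

The Poincaré function `F` is given by its Taylor series. Near `0` it is injective and preserves the
upper half-plane, so `X = arccos (1 + F / ξ)` is defined and injective on a small half-disc, with
`X (ρ v) = L (X v)`. This equation extends `X` to the upper half-plane by `X (ρ ^ n v) = L^n (X v)`
(`IsCombLift`). Injectivity of `X`, the inclusion of its image in the comb, and the identity
`ξ cos X = F + ξ` pass from the half-disc to the half-plane. For surjectivity, follow a point of the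
comb backward under `L`: after finitely many steps the orbit stays in the half-strip
`-π / 2 ≤ Re t < 0`, where the inverse branch of `P` is the principal square root and contracts to
`ξ`, so the orbit reaches the image of the half-disc, uniformly on bounded sets
(`exists_backward_orbit`, `IsCombLift.exists_eq`).

Another normalized comb map differs from `X / π` by an automorphism of the upper half-plane which
fixes `0` and `∞`; by the Schwarz lemma it is a dilation, and the normalization of the derivative
makes it the identity (`IsCombLift.eqOn_of_isNormalizedCombMap`). Finally `F → ∞` in sectors because
`Im L t ≥ 2 Im t` (`IsCombLift.tendsto_sector`).
-/

/-! ### The sine on the upper half-plane -/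

theorem Complex.sin_re (t : ℂ) : (Complex.sin t).re = Real.sin t.re * Real.cosh t.im := by
  rw [Complex.sin_eq]
  simp [← Complex.ofReal_sin, ← Complex.ofReal_cos, ← Complex.ofReal_sinh, ← Complex.ofReal_cosh]

theorem Complex.sin_im (t : ℂ) : (Complex.sin t).im = Real.cos t.re * Real.sinh t.im := by
  rw [Complex.sin_eq]
  simp [← Complex.ofReal_sin, ← Complex.ofReal_cos, ← Complex.ofReal_sinh, ← Complex.ofReal_cosh]

theorem Complex.cos_re (t : ℂ) : (Complex.cos t).re = Real.cos t.re * Real.cosh t.im := by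
  rw [Complex.cos_eq]
  simp [← Complex.ofReal_sin, ← Complex.ofReal_cos, ← Complex.ofReal_sinh, ← Complex.ofReal_cosh]

theorem Complex.cos_im (t : ℂ) : (Complex.cos t).im = -(Real.sin t.re * Real.sinh t.im) := by
  rw [Complex.cos_eq]
  simp [← Complex.ofReal_sin, ← Complex.ofReal_cos, ← Complex.ofReal_sinh, ← Complex.ofReal_cosh]

theorem Complex.sin_ne_zero_of_im_pos {t : ℂ} (ht : 0 < t.im) : Complex.sin t ≠ 0 := by
  intro h
  have hre := congrArg Complex.re h
  have him := congrArg Complex.im h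
  rw [Complex.sin_re, Complex.zero_re, mul_eq_zero] at hre
  rw [Complex.sin_im, Complex.zero_im, mul_eq_zero] at him
  have h1 := hre.resolve_right (Real.cosh_pos _).ne'
  have h2 := him.resolve_right (Real.sinh_pos_iff.2 ht).ne'
  nlinarith [Real.sin_sq_add_cos_sq t.re]

theorem Complex.norm_sin_sub_one (t : ℂ) :
    ‖Complex.sin t - 1‖ = Real.cosh t.im - Real.sin t.re := by
  have h0 : 0 ≤ Real.cosh t.im - Real.sin t.re := by
    linarith [Real.one_le_cosh t.im, Real.sin_le_one t.re]
  rw [← sq_eq_sq₀ (norm_nonneg _) h0, ← Complex.normSq_eq_norm_sq, Complex.normSq_apply]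
  simp only [Complex.sub_re, Complex.sub_im, Complex.one_re, Complex.one_im, Complex.sin_re,
    Complex.sin_im]
  have h1 := Real.sin_sq_add_cos_sq t.re
  have h2 := Real.cosh_sq t.im
  linear_combination (Real.sinh t.im ^ 2) * h1 + (Real.sin t.re ^ 2 - 1) * h2

theorem Complex.norm_sin_add_one (t : ℂ) :
    ‖Complex.sin t + 1‖ = Real.cosh t.im + Real.sin t.re := by
  have h := Complex.norm_sin_sub_one (-t)
  rw [Complex.sin_neg, ← norm_neg] at h
  simpa [add_comm] using h

/-- Two points of the upper half-plane with the same sine differ by a multiple of `2π`. -/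
theorem Complex.exists_of_sin_eq_sin {a b : ℂ} (ha : 0 < a.im) (hb : 0 < b.im)
    (h : Complex.sin a = Complex.sin b) : ∃ k : ℤ, a = b + k * (2 * Real.pi) := by
  obtain ⟨k, hk | hk⟩ := Complex.sin_eq_sin_iff.1 h
  · exact ⟨-k, by rw [hk]; push_cast; ring⟩
  · exfalso
    have := congrArg Complex.im hk
    simp at this
    linarith

theorem Complex.exists_of_cos_eq_cos {a b : ℂ} (ha : 0 < a.im) (hb : 0 < b.im)
    (h : Complex.cos a = Complex.cos b) : ∃ k : ℤ, a = b + k * (2 * Real.pi) := by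
  obtain ⟨k, hk | hk⟩ := Complex.cos_eq_cos_iff.1 h
  · exact ⟨-k, by rw [hk]; push_cast; ring⟩
  · exfalso
    have := congrArg Complex.im hk
    simp at this
    linarith

/-- The cosine is injective on a vertical half-strip of width less than `2π`. -/
theorem Complex.eq_of_cos_eq_cos {a b : ℂ} (ha : 0 < a.im) (hb : 0 < b.im)
    (h : Complex.cos a = Complex.cos b) (hab : |a.re - b.re| < 2 * Real.pi) : a = b := by
  obtain ⟨k, hk⟩ := Complex.exists_of_cos_eq_cos ha hb h
  have hre : a.re - b.re = k * (2 * Real.pi) := by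
    rw [hk]; simp
  rw [hre, abs_mul, abs_of_pos (by positivity : (0 : ℝ) < 2 * Real.pi)] at hab
  have hk1 : |(k : ℝ)| < 1 := by
    have := Real.pi_pos
    by_contra hcon
    push Not at hcon
    nlinarith
  have hk0 : k = 0 := by
    rw [← Int.cast_abs] at hk1
    have : |k| < 1 := by exact_mod_cast hk1
    exact Int.abs_lt_one_iff.1 this
  simpa [hk0] using hk

/-- The upper half-plane is mapped by the sine onto the complement of `[-1, 1]`. -/
theorem Complex.exists_im_pos_sin_eq {z : ℂ} (hz : ∀ x : ℝ, |x| ≤ 1 → z ≠ x) :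
    ∃ t : ℂ, 0 < t.im ∧ Complex.sin t = z := by
  obtain ⟨t, rfl⟩ := Complex.sin_surjective z
  rcases lt_trichotomy t.im 0 with h | h | h
  · exact ⟨Real.pi - t, by simpa using h, Complex.sin_pi_sub t⟩
  · exfalso
    refine hz (Real.sin t.re) (Real.abs_sin_le_one _) ?_
    rw [Complex.ofReal_sin]
    congr 1
    exact Complex.ext (by simp) (by simp [h])
  · exact ⟨t, h, rfl⟩

/-- The upper half-plane is mapped by the sine into the complement of `[-1, 1]`. -/
theorem Complex.sin_ne_ofReal_of_im_pos {t : ℂ} (ht : 0 < t.im) {x : ℝ} (hx : |x| ≤ 1) :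
    Complex.sin t ≠ x := by
  intro h
  have h1 := Complex.norm_sin_sub_one t
  have h2 := Complex.norm_sin_add_one t
  rw [h, ← Complex.ofReal_one, ← Complex.ofReal_sub, Complex.norm_real, Real.norm_eq_abs,
    abs_of_nonpos (by linarith [abs_le.1 hx])] at h1
  rw [h, ← Complex.ofReal_one, ← Complex.ofReal_add, Complex.norm_real, Real.norm_eq_abs,
    abs_of_nonneg (by linarith [abs_le.1 hx])] at h2
  have := Real.one_lt_cosh.2 ht.ne'
  linarith

/-! ### Square roots in the right half-plane -/

theorem Complex.sq_sqrt (a : ℂ) : a.sqrt ^ 2 = a := by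
  rw [Complex.sqrt]
  exact_mod_cast Complex.cpow_nat_inv_pow a two_ne_zero

theorem Complex.re_sqrt_pos {a : ℂ} (ha : a ∈ Complex.slitPlane) : 0 < a.sqrt.re := by
  have hn : 0 < ‖a‖ + a.re := by
    rcases ha with h1 | h1
    · have := norm_nonneg a; linarith
    · linarith [neg_abs_le a.re, Complex.abs_re_lt_norm.2 h1]
  rw [Complex.sqrt, Complex.cpow_inv_two_re]
  exact Real.sqrt_pos.2 (by linarith)

theorem Complex.im_sqrt_neg {a : ℂ} (ha : a.im < 0) : a.sqrt.im < 0 := by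
  rw [Complex.sqrt, Complex.cpow_inv_two_im_eq_neg_sqrt ha, neg_lt_zero]
  apply Real.sqrt_pos.2
  linarith [le_abs_self a.re, Complex.abs_re_lt_norm.2 ha.ne]

theorem DifferentiableAt.complexSqrt {f : ℂ → ℂ} {t : ℂ} (hf : DifferentiableAt ℂ f t)
    (h : f t ∈ Complex.slitPlane) : DifferentiableAt ℂ (fun z => (f z).sqrt) t :=
  hf.cpow_const h

theorem Complex.sq_mem_slitPlane_of_re_pos {m : ℂ} (hm : 0 < m.re) : m ^ 2 ∈ Complex.slitPlane := by
  rw [Complex.mem_slitPlane_iff]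
  by_cases h : m.im = 0
  · left
    simp only [pow_two, Complex.mul_re, h]
    nlinarith
  · right
    simp only [pow_two, Complex.mul_im]
    intro h'
    have : m.re * m.im = 0 := by linarith
    rcases mul_eq_zero.1 this with h1 | h1
    · exact hm.ne' h1
    · exact h h1

theorem Complex.ofReal_add_mem_slitPlane {a : ℂ} (ha : a ∈ Complex.slitPlane) {c : ℝ}
    (hc : 0 ≤ c) : (c : ℂ) + a ∈ Complex.slitPlane := by
  rw [Complex.mem_slitPlane_iff] at ha ⊢
  simp only [Complex.add_re, Complex.ofReal_re, Complex.add_im, Complex.ofReal_im, zero_add]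
  exact ha.imp (fun h => by linarith) id

/-! ### The conformal map with `sin (S t) = κ sin t` -/

/-- `i cot t`, a function with positive real part on the upper half-plane. -/
noncomputable def iCot (t : ℂ) : ℂ := Complex.I * Complex.cos t / Complex.sin t

theorem iCot_re_pos {t : ℂ} (ht : 0 < t.im) : 0 < (iCot t).re := by
  have hs := Complex.sin_ne_zero_of_im_pos ht
  have hn : 0 < Complex.normSq (Complex.sin t) := Complex.normSq_pos.2 hs
  have : (iCot t).re = Real.cosh t.im * Real.sinh t.im / Complex.normSq (Complex.sin t) := by
    rw [iCot, Complex.div_re]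
    simp only [Complex.mul_re, Complex.mul_im, Complex.I_re, Complex.I_im, Complex.cos_re,
      Complex.cos_im, Complex.sin_re, Complex.sin_im]
    rw [← add_div]
    congr 1
    linear_combination (Real.cosh t.im * Real.sinh t.im) * Real.sin_sq_add_cos_sq t.re
  rw [this]
  exact div_pos (mul_pos (Real.cosh_pos _) (Real.sinh_pos_iff.2 ht)) hn

theorem iCot_sq {t : ℂ} (ht : 0 < t.im) : iCot t ^ 2 = 1 - 1 / Complex.sin t ^ 2 := by
  have hs := Complex.sin_ne_zero_of_im_pos ht
  rw [iCot]
  field_simp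
  rw [Complex.I_sq]
  linear_combination -Complex.sin_sq_add_cos_sq t

theorem iCot_add_one {t : ℂ} (ht : 0 < t.im) :
    Complex.exp (Complex.I * t) * (iCot t + 1) = Complex.I / Complex.sin t := by
  have hs := Complex.sin_ne_zero_of_im_pos ht
  rw [iCot, mul_comm Complex.I t, Complex.exp_mul_I]
  field_simp
  linear_combination Complex.I * Complex.sin_sq_add_cos_sq t +
    Complex.sin t * Complex.cos t * Complex.I_sq

/-- `κ` times `i cot (S t)`; the square root has positive real part. -/
noncomputable def iCotLift (κ : ℝ) (t : ℂ) : ℂ := (((κ ^ 2 - 1 : ℝ) : ℂ) + iCot t ^ 2).sqrt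

/-- The conformal map `S` of the upper half-plane into itself with `sin (S t) = κ sin t` and
`S (t + π) = S t + π`. The formula comes from `exp (i S t) = i / ((n + κ) sin t)`, where
`n = κ i cot (S t)`, and `exp (i t) (i cot t + 1) = i / sin t`. -/
noncomputable def sinScale (κ : ℝ) (t : ℂ) : ℂ :=
  t - Complex.I * (Complex.log (iCot t + 1) - Complex.log (iCotLift κ t + κ))

section sinScale

variable {κ : ℝ} {t : ℂ}

theorem iCotLift_sq (ht : 0 < t.im) : iCotLift κ t ^ 2 = κ ^ 2 - 1 / Complex.sin t ^ 2 := by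
  rw [iCotLift, Complex.sq_sqrt, iCot_sq ht]
  push_cast
  ring

theorem iCotLift_arg_mem_slitPlane (hκ : 1 ≤ κ) (ht : 0 < t.im) :
    ((κ ^ 2 - 1 : ℝ) : ℂ) + iCot t ^ 2 ∈ Complex.slitPlane :=
  Complex.ofReal_add_mem_slitPlane (Complex.sq_mem_slitPlane_of_re_pos (iCot_re_pos ht))
    (by nlinarith)

theorem iCotLift_re_pos (hκ : 1 ≤ κ) (ht : 0 < t.im) : 0 < (iCotLift κ t).re :=
  Complex.re_sqrt_pos (iCotLift_arg_mem_slitPlane hκ ht)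

theorem iCot_add_one_re_pos (ht : 0 < t.im) : 0 < (iCot t + 1).re := by
  have := iCot_re_pos ht
  simp only [Complex.add_re, Complex.one_re]
  linarith

theorem iCotLift_add_re_pos (hκ : 1 ≤ κ) (ht : 0 < t.im) : 0 < (iCotLift κ t + κ).re := by
  have := iCotLift_re_pos hκ ht
  simp only [Complex.add_re, Complex.ofReal_re]
  linarith

/-- The formula from which both `sin (S t) = κ sin t` and `|exp (i S t)| < 1` follow. -/
theorem exp_I_mul_sinScale (hκ : 1 ≤ κ) (ht : 0 < t.im) :
    Complex.exp (Complex.I * sinScale κ t) = Complex.I / ((iCotLift κ t + κ) * Complex.sin t) := by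
  have h1 : iCot t + 1 ≠ 0 := fun h => by
    have := iCot_add_one_re_pos ht
    rw [h] at this
    simp at this
  have h2 : iCotLift κ t + κ ≠ 0 := fun h => by
    have := iCotLift_add_re_pos hκ ht
    rw [h] at this
    simp at this
  have : Complex.I * sinScale κ t = Complex.I * t +
      (Complex.log (iCot t + 1) - Complex.log (iCotLift κ t + κ)) := by
    rw [sinScale]
    linear_combination (-(Complex.log (iCot t + 1) - Complex.log (iCotLift κ t + κ))) *
      Complex.I_sq
  rw [this, Complex.exp_add, Complex.exp_sub, Complex.exp_log h1, Complex.exp_log h2,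
    ← mul_div_assoc, iCot_add_one ht, div_div, mul_comm (Complex.sin t)]

theorem sin_sinScale (hκ : 1 ≤ κ) (ht : 0 < t.im) :
    Complex.sin (sinScale κ t) = κ * Complex.sin t := by
  have hs := Complex.sin_ne_zero_of_im_pos ht
  have h2 : iCotLift κ t + κ ≠ 0 := fun h => by
    have := iCotLift_add_re_pos hκ ht
    rw [h] at this
    simp at this
  have hn := iCotLift_sq (κ := κ) ht
  have he := exp_I_mul_sinScale hκ ht
  have he' : Complex.exp (-(Complex.I * sinScale κ t)) =
      -Complex.I * ((iCotLift κ t + κ) * Complex.sin t) := by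
    rw [Complex.exp_neg, he, inv_div, div_eq_iff Complex.I_ne_zero]
    linear_combination ((iCotLift κ t + κ) * Complex.sin t) * Complex.I_sq
  rw [Complex.sin, mul_comm _ Complex.I, neg_mul, mul_comm _ Complex.I, he, he']
  field_simp at hn ⊢
  rw [Complex.I_sq]
  linear_combination hn

theorem sinScale_im_pos (hκ : 1 ≤ κ) (ht : 0 < t.im) : 0 < (sinScale κ t).im := by
  have hs := Complex.sin_ne_zero_of_im_pos ht
  have hre := iCotLift_re_pos hκ ht
  have h2 : iCotLift κ t + κ ≠ 0 := fun h => by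
    have := iCotLift_add_re_pos hκ ht
    rw [h] at this
    simp at this
  have he := exp_I_mul_sinScale hκ ht
  have hsq : Complex.exp (Complex.I * sinScale κ t) ^ 2 =
      (iCotLift κ t - κ) / (iCotLift κ t + κ) := by
    have hn := iCotLift_sq (κ := κ) ht
    rw [he]
    field_simp at hn ⊢
    rw [Complex.I_sq]
    linear_combination -hn
  have hlt : ‖Complex.exp (Complex.I * sinScale κ t) ^ 2‖ < 1 := by
    rw [hsq, norm_div, div_lt_one (norm_pos_iff.2 h2), ← sq_lt_sq₀ (norm_nonneg _) (norm_nonneg _),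
      ← Complex.normSq_eq_norm_sq, ← Complex.normSq_eq_norm_sq, Complex.normSq_apply,
      Complex.normSq_apply]
    simp only [Complex.sub_re, Complex.sub_im, Complex.add_re, Complex.add_im, Complex.ofReal_re,
      Complex.ofReal_im]
    nlinarith
  rw [norm_pow, Complex.norm_exp] at hlt
  by_contra hcon
  have : 1 ≤ Real.exp (Complex.I * sinScale κ t).re := by
    apply Real.one_le_exp
    simp at hcon ⊢
    exact hcon
  nlinarith

theorem sinScale_add_pi (κ : ℝ) (t : ℂ) : sinScale κ (t + Real.pi) = sinScale κ t + Real.pi := by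
  have : iCot (t + Real.pi) = iCot t := by
    simp [iCot, Complex.sin_add_pi, Complex.cos_add_pi]
  simp only [sinScale, iCotLift, this]
  ring

theorem sinScale_add_int_mul_pi (κ : ℝ) (t : ℂ) (k : ℤ) :
    sinScale κ (t + k * Real.pi) = sinScale κ t + k * Real.pi := by
  induction k with
  | zero => simp
  | succ i ih =>
    have h := sinScale_add_pi κ (t + (i : ℤ) * Real.pi)
    rw [ih] at h
    push_cast at h ⊢
    rw [add_mul, one_mul, ← add_assoc, ← add_assoc, h]
  | pred i ih =>
    have h := sinScale_add_pi κ (t + ((-(i : ℤ) - 1 : ℤ) : ℂ) * Real.pi)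
    have e : t + ((-(i : ℤ) - 1 : ℤ) : ℂ) * Real.pi + Real.pi =
        t + ((-(i : ℤ) : ℤ) : ℂ) * Real.pi := by
      push_cast; ring
    rw [e, ih] at h
    push_cast at h ⊢
    linear_combination -h

theorem differentiableAt_sinScale (hκ : 1 ≤ κ) (ht : 0 < t.im) :
    DifferentiableAt ℂ (sinScale κ) t := by
  have hs := Complex.sin_ne_zero_of_im_pos ht
  have hc : DifferentiableAt ℂ iCot t := by
    unfold iCot
    fun_prop (disch := assumption)
  have hl : DifferentiableAt ℂ (iCotLift κ) t :=
    ((differentiableAt_const _).add (hc.pow 2)).complexSqrt (iCotLift_arg_mem_slitPlane hκ ht)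
  refine differentiableAt_id.sub (DifferentiableAt.const_mul ?_ _)
  exact ((hc.add_const _).clog (.inl (iCot_add_one_re_pos ht))).sub
    ((hl.add_const _).clog (.inl (iCotLift_add_re_pos hκ ht)))

/-- The two logarithms in the definition of `S` have imaginary parts in `(-π / 2, π / 2)`. -/
theorem abs_sinScale_re_sub_lt (hκ : 1 ≤ κ) (ht : 0 < t.im) :
    |(sinScale κ t).re - t.re| < Real.pi := by
  have h1 := Complex.abs_arg_lt_pi_div_two_iff.2 (.inl (iCot_add_one_re_pos ht))
  have h2 := Complex.abs_arg_lt_pi_div_two_iff.2 (.inl (iCotLift_add_re_pos hκ ht))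
  have : (sinScale κ t).re - t.re = Complex.arg (iCot t + 1) - Complex.arg (iCotLift κ t + κ) := by
    simp [sinScale, Complex.log_im]
  rw [this]
  rw [abs_lt] at *
  constructor <;> linarith [h1.1, h1.2, h2.1, h2.2]

/-- The sine determines a point of the upper half-plane modulo `2π`, and `S` commutes with
translations by multiples of `π`. -/
theorem sinScale_injOn (hκ : 1 ≤ κ) : Set.InjOn (sinScale κ) {t | 0 < t.im} := by
  intro a ha b hb hab
  have h : Complex.sin a = Complex.sin b := by
    have := congrArg Complex.sin hab
    rw [sin_sinScale hκ ha, sin_sinScale hκ hb] at this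
    exact mul_left_cancel₀ (by exact_mod_cast (by linarith : κ ≠ 0)) this
  obtain ⟨k, hk⟩ := Complex.exists_of_sin_eq_sin ha hb h
  have h2 := sinScale_add_int_mul_pi κ b (2 * k)
  rw [show b + ((2 * k : ℤ) : ℂ) * Real.pi = a by rw [hk]; push_cast; ring, hab] at h2
  have h3 : ((2 * k : ℤ) : ℂ) * Real.pi = 0 := by linear_combination -h2
  rw [hk]
  push_cast at h3
  linear_combination h3

/-- The image of the upper half-plane under `S` consists of the points of the upper half-plane
at which the sine takes no value in `[-κ, κ]`. -/
theorem exists_sinScale_eq_iff (hκ : 1 ≤ κ) {τ : ℂ} (hτ : 0 < τ.im) :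
    (∃ t : ℂ, 0 < t.im ∧ sinScale κ t = τ) ↔ ∀ x : ℝ, |x| ≤ κ → Complex.sin τ ≠ x := by
  have hκ0 : 0 < κ := by linarith
  have hκc : (κ : ℂ) ≠ 0 := by exact_mod_cast hκ0.ne'
  constructor
  · rintro ⟨t, ht, rfl⟩ x hx h
    rw [sin_sinScale hκ ht] at h
    refine Complex.sin_ne_ofReal_of_im_pos ht (x := x / κ) ?_ ?_
    · rwa [abs_div, abs_of_pos hκ0, div_le_one hκ0]
    · push_cast
      field_simp
      linear_combination h
  · intro h
    obtain ⟨t, ht, hst⟩ := Complex.exists_im_pos_sin_eq (z := Complex.sin τ / κ) (by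
      intro x hx hx'
      refine h (κ * x) ?_ ?_
      · rw [abs_mul, abs_of_pos hκ0]
        nlinarith
      · rw [div_eq_iff hκc] at hx'
        rw [hx']
        push_cast
        ring)
    have h1 : Complex.sin τ = Complex.sin (sinScale κ t) := by
      rw [sin_sinScale hκ ht, hst]
      field_simp
    obtain ⟨k, hk⟩ := Complex.exists_of_sin_eq_sin hτ (sinScale_im_pos hκ ht) h1
    refine ⟨t + (2 * k : ℤ) * Real.pi, by simpa using ht, ?_⟩
    rw [sinScale_add_int_mul_pi, hk]
    push_cast
    ring

/-- The map `S` scales the real and the imaginary part of the sine by positive factors, so it keeps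
the sign of `sin (Re t - k π / 2)`, which up to sign is the sine or the cosine of `Re t`. -/
theorem exists_sin_sinScale_re_sub (hκ : 1 ≤ κ) (ht : 0 < t.im) (k : ℤ) :
    ∃ q : ℝ, 0 < q ∧ Real.sin ((sinScale κ t).re - k * (Real.pi / 2)) =
      q * Real.sin (t.re - k * (Real.pi / 2)) := by
  have h := sin_sinScale hκ ht
  have h1 := congrArg Complex.re h
  have h2 := congrArg Complex.im h
  rw [Complex.re_ofReal_mul, Complex.sin_re, Complex.sin_re] at h1
  rw [Complex.im_ofReal_mul, Complex.sin_im, Complex.sin_im] at h2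
  have hc1 := Real.cosh_pos (sinScale κ t).im
  have hc2 := Real.cosh_pos t.im
  have hs1 := Real.sinh_pos_iff.2 (sinScale_im_pos hκ ht)
  have hs2 := Real.sinh_pos_iff.2 ht
  have hκ0 : 0 < κ := by linarith
  rw [Real.sin_sub, Real.sin_sub]
  have hor : Real.sin (k * (Real.pi / 2)) = 0 ∨ Real.cos (k * (Real.pi / 2)) = 0 := by
    have : Real.sin (2 * (k * (Real.pi / 2))) = 0 := by
      rw [show 2 * ((k : ℝ) * (Real.pi / 2)) = k * Real.pi by ring]
      exact Real.sin_int_mul_pi k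
    rw [Real.sin_two_mul] at this
    simpa using this
  generalize (k : ℝ) * (Real.pi / 2) = c at hor ⊢
  rcases hor with h0 | h0
  · refine ⟨κ * Real.cosh t.im / Real.cosh (sinScale κ t).im, by positivity, ?_⟩
    rw [h0]
    field_simp
    linear_combination Real.cos c * h1
  · refine ⟨κ * Real.sinh t.im / Real.sinh (sinScale κ t).im, by positivity, ?_⟩
    rw [h0]
    field_simp
    linear_combination (-Real.sin c) * h2

/-- `S` respects the position with respect to the vertical lines through the multiples of
`π / 2`. -/
theorem sinScale_re_lt_iff (hκ : 1 ≤ κ) (ht : 0 < t.im) (k : ℤ) :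
    ((sinScale κ t).re < k * (Real.pi / 2) ↔ t.re < k * (Real.pi / 2)) ∧
    ((sinScale κ t).re = k * (Real.pi / 2) ↔ t.re = k * (Real.pi / 2)) := by
  obtain ⟨q, hq, h⟩ := exists_sin_sinScale_re_sub hκ ht k
  have hab := abs_lt.1 (abs_sinScale_re_sub_lt hκ ht)
  set x' := (sinScale κ t).re - k * (Real.pi / 2) with hx'
  set x := t.re - k * (Real.pi / 2) with hx
  have hab' : -Real.pi < x' - x ∧ x' - x < Real.pi := by
    constructor <;> linarith [hab.1, hab.2]
  have hpos : 0 < x → 0 < x' := by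
    intro hx0
    by_contra hcon
    have h1 : 0 < Real.sin x := Real.sin_pos_of_pos_of_lt_pi hx0 (by linarith)
    have h2 : Real.sin x' ≤ 0 := Real.sin_nonpos_of_nonpos_of_neg_pi_le (by linarith) (by linarith)
    nlinarith
  have hneg : x < 0 → x' < 0 := by
    intro hx0
    by_contra hcon
    have h1 : Real.sin x < 0 := Real.sin_neg_of_neg_of_neg_pi_lt hx0 (by linarith)
    have h2 : 0 ≤ Real.sin x' := Real.sin_nonneg_of_nonneg_of_le_pi (by linarith) (by linarith)
    nlinarith
  have hzero : x = 0 → x' = 0 := by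
    intro hx0
    rw [hx0, Real.sin_zero, mul_zero] at h
    exact (Real.sin_eq_zero_iff_of_lt_of_lt (by linarith) (by linarith)).1 h
  have e1 : (sinScale κ t).re = x' + k * (Real.pi / 2) := by rw [hx']; ring
  have e2 : t.re = x + k * (Real.pi / 2) := by rw [hx]; ring
  rw [e1, e2]
  rcases lt_trichotomy x 0 with h0 | h0 | h0
  · have := hneg h0
    constructor <;> constructor <;> intro <;> linarith
  · have := hzero h0
    constructor <;> constructor <;> intro <;> linarith
  · have := hpos h0
    constructor <;> constructor <;> intro <;> linarith

theorem two_mul_cosh_sinScale_im (hκ : 1 ≤ κ) (ht : 0 < t.im) :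
    2 * Real.cosh (sinScale κ t).im = ‖κ * Complex.sin t - 1‖ + ‖κ * Complex.sin t + 1‖ := by
  rw [← sin_sinScale hκ ht, Complex.norm_sin_sub_one, Complex.norm_sin_add_one]
  ring

/-- `S` does not decrease imaginary parts: dilating the plane by `κ ≥ 1` does not decrease the sum
of the distances to the foci `±1`. -/
theorem im_le_sinScale_im (hκ : 1 ≤ κ) (ht : 0 < t.im) : t.im ≤ (sinScale κ t).im := by
  have h1 := two_mul_cosh_sinScale_im hκ ht
  have h2 : 2 * Real.cosh t.im = ‖Complex.sin t - 1‖ + ‖Complex.sin t + 1‖ := by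
    rw [Complex.norm_sin_sub_one, Complex.norm_sin_add_one]
    ring
  set s := Complex.sin t
  have e1 : ‖2 * κ * (s - 1)‖ ≤ ‖(κ + 1) * (κ * s - 1)‖ + ‖(κ - 1) * (κ * s + 1)‖ := by
    have : 2 * κ * (s - 1) = (κ + 1) * (κ * s - 1) - (κ - 1) * (κ * s + 1) := by ring
    rw [this]
    exact norm_sub_le _ _
  have e2 : ‖2 * κ * (s + 1)‖ ≤ ‖(κ + 1) * (κ * s + 1)‖ + ‖(κ - 1) * (κ * s - 1)‖ := by
    have : 2 * κ * (s + 1) = (κ + 1) * (κ * s + 1) - (κ - 1) * (κ * s - 1) := by ring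
    rw [this]
    exact norm_sub_le _ _
  have n1 : ‖(κ : ℂ) + 1‖ = κ + 1 := by
    rw [← Complex.ofReal_one, ← Complex.ofReal_add, Complex.norm_real, Real.norm_eq_abs,
      abs_of_nonneg (by linarith)]
  have n2 : ‖(κ : ℂ) - 1‖ = κ - 1 := by
    rw [← Complex.ofReal_one, ← Complex.ofReal_sub, Complex.norm_real, Real.norm_eq_abs,
      abs_of_nonneg (by linarith)]
  have n3 : ‖(κ : ℂ)‖ = κ := by
    rw [Complex.norm_real, Real.norm_eq_abs, abs_of_nonneg (by linarith)]
  simp only [norm_mul, n1, n2, n3, Complex.norm_ofNat] at e1 e2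
  have h3 : Real.cosh t.im ≤ Real.cosh (sinScale κ t).im := by
    have hκ0 : 0 < κ := by linarith
    have : κ * (2 * Real.cosh t.im) ≤ κ * (2 * Real.cosh (sinScale κ t).im) := by
      rw [h1, h2]
      nlinarith
    have := le_of_mul_le_mul_left this hκ0
    linarith
  rwa [Real.cosh_le_cosh, abs_of_pos ht, abs_of_pos (sinScale_im_pos hκ ht)] at h3

theorem sinScale_im_le (hκ : 1 ≤ κ) (ht : 0 < t.im) :
    (sinScale κ t).im ≤ κ * Real.cosh t.im + 1 := by
  have h1 := two_mul_cosh_sinScale_im hκ ht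
  have hκ0 : 0 < κ := by linarith
  have n0 : ‖(κ : ℂ) * Complex.sin t‖ ≤ κ * Real.cosh t.im := by
    rw [norm_mul, Complex.norm_real, Real.norm_eq_abs, abs_of_pos hκ0]
    gcongr
    have e1 := Complex.norm_sin_sub_one t
    have e2 := Complex.norm_sin_add_one t
    have e3 : ‖(2 : ℂ) * Complex.sin t‖ ≤ ‖Complex.sin t - 1‖ + ‖Complex.sin t + 1‖ := by
      rw [show 2 * Complex.sin t = (Complex.sin t - 1) + (Complex.sin t + 1) by ring]
      exact norm_add_le _ _
    rw [norm_mul, Complex.norm_ofNat] at e3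
    linarith
  have n1 := norm_sub_le ((κ : ℂ) * Complex.sin t) 1
  have n2 := norm_add_le ((κ : ℂ) * Complex.sin t) 1
  rw [norm_one] at n1 n2
  have h3 := Real.cosh_sq (sinScale κ t).im
  have h4 := Real.self_le_sinh_iff.2 (sinScale_im_pos hκ ht).le
  have h5 := Real.sinh_lt_cosh (sinScale κ t).im
  linarith

end sinScale

/-! ### The comb and its self-map -/

/-- The comb domain dilated by `π`: a point of the quadrant on the vertical line of a slit has to
lie above the slit. -/
noncomputable def scaledComb (lam xi : ℝ) : Set ℂ :=
  {t : ℂ | t.re < 0 ∧ 0 < t.im ∧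
    ∀ l : ℕ, 1 ≤ l → t.re = -(l * Real.pi) → Real.pi * slitHeight lam xi l < t.im}

/-- The expanding map `L = 2 S` of the quadrant, a lift of the polynomial through `ξ cos`. -/
noncomputable def combStep (xi : ℝ) (t : ℂ) : ℂ := 2 * sinScale (√(xi / 2)) t

theorem quadP_ofReal (lam x : ℝ) : quadP (lam : ℂ) (x : ℂ) = (quadP lam x : ℝ) := by
  simp [quadP]

section combStep

variable {lam xi : ℝ}

theorem mem_combDomain_iff (hlam : 2 < lam) (hxi : 0 ≤ xi) (hfix : quadP lam xi = xi) {z : ℂ} :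
    z ∈ combDomain lam xi ↔ (Real.pi : ℂ) * z ∈ scaledComb lam xi := by
  have hpi := Real.pi_pos
  simp only [combDomain, scaledComb, Set.mem_sdiff, Set.mem_iUnion, Set.mem_ofPred_eq,
    Complex.re_ofReal_mul, Complex.im_ofReal_mul, not_exists, exists_prop, not_and]
  have h1 : Real.pi * z.re < 0 ↔ z.re < 0 := by
    constructor <;> intro h <;> nlinarith
  have h2 : 0 < Real.pi * z.im ↔ 0 < z.im := by
    constructor
    · intro h; exact pos_of_mul_pos_right h hpi.le
    · intro h; positivity
  rw [h1, h2, and_assoc]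
  refine and_congr_right fun _ => and_congr_right fun hz => forall₂_congr fun l hl => ?_
  have hh := slitHeight_nonneg hlam hxi hfix hl
  have hseg : z ∈ segment ℝ (-(l : ℂ)) (-(l : ℂ) + Complex.I * (slitHeight lam xi l : ℂ)) ↔
      z.re = -l ∧ z.im ≤ slitHeight lam xi l := by
    rw [segment_eq_image']
    simp only [add_sub_cancel_left, Set.mem_image]
    constructor
    · rintro ⟨θ, hθ, rfl⟩
      refine ⟨by simp, ?_⟩
      simp
      exact mul_le_of_le_one_left hh hθ.2
    · rintro ⟨hre, him⟩
      have hpos : 0 < slitHeight lam xi l := hz.trans_le him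
      refine ⟨z.im / slitHeight lam xi l, ⟨by positivity, by rwa [div_le_one hpos]⟩, ?_⟩
      apply Complex.ext
      · simp [hre]
      · simp
        field_simp
  rw [hseg, not_and, not_le]
  refine imp_congr ⟨fun h => by rw [h]; ring, fun h => ?_⟩ ⟨fun h => by gcongr, fun h => ?_⟩
  · exact mul_left_cancel₀ hpi.ne' (by rw [h]; ring)
  · exact lt_of_mul_lt_mul_left h hpi.le

theorem one_le_sqrt_half (hlam : 2 < lam) (hxi : 0 ≤ xi) (hfix : quadP lam xi = xi) :
    1 ≤ √(xi / 2) := by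
  rw [Real.one_le_sqrt]
  linarith [two_lt_fixedPoint hlam hxi hfix]

theorem combStep_im_pos (hlam : 2 < lam) (hxi : 0 ≤ xi) (hfix : quadP lam xi = xi) {t : ℂ}
    (ht : 0 < t.im) : 0 < (combStep xi t).im := by
  have := sinScale_im_pos (one_le_sqrt_half hlam hxi hfix) ht
  have e : (combStep xi t).im = 2 * (sinScale (√(xi / 2)) t).im := by simp [combStep]
  linarith

/-- `L` is a lift of the polynomial through `ξ cos`. -/
theorem cos_combStep (hlam : 2 < lam) (hxi : 0 ≤ xi) (hfix : quadP lam xi = xi) {t : ℂ}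
    (ht : 0 < t.im) :
    (xi : ℂ) * Complex.cos (combStep xi t) = quadP (lam : ℂ) ((xi : ℂ) * Complex.cos t) := by
  have hs := sin_sinScale (one_le_sqrt_half hlam hxi hfix) ht
  have hk : ((√(xi / 2) : ℝ) : ℂ) ^ 2 = xi / 2 := by
    rw [← Complex.ofReal_pow, Real.sq_sqrt (by linarith)]
    push_cast
    ring
  have hl : (lam : ℂ) = xi ^ 2 - xi := by
    rw [quadP] at hfix
    rw [← Complex.ofReal_pow, ← Complex.ofReal_sub]
    congr 1
    linarith
  rw [combStep, Complex.cos_two_mul, Complex.cos_sq', hs, mul_pow, hk, quadP, mul_pow,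
    Complex.cos_sq', hl]
  ring

theorem combStep_re_lt_iff (hlam : 2 < lam) (hxi : 0 ≤ xi) (hfix : quadP lam xi = xi) {t : ℂ}
    (ht : 0 < t.im) (k : ℤ) :
    ((combStep xi t).re < k * Real.pi ↔ t.re < k * (Real.pi / 2)) ∧
    ((combStep xi t).re = k * Real.pi ↔ t.re = k * (Real.pi / 2)) := by
  obtain ⟨h1, h2⟩ := sinScale_re_lt_iff (one_le_sqrt_half hlam hxi hfix) ht k
  rw [← h1, ← h2]
  have : (combStep xi t).re = 2 * (sinScale (√(xi / 2)) t).re := by simp [combStep]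
  rw [this]
  constructor <;> constructor <;> intro <;> linarith

theorem combStep_re_neg_iff (hlam : 2 < lam) (hxi : 0 ≤ xi) (hfix : quadP lam xi = xi) {t : ℂ}
    (ht : 0 < t.im) : (combStep xi t).re < 0 ↔ t.re < 0 := by
  simpa using (combStep_re_lt_iff hlam hxi hfix ht 0).1

theorem combStep_injOn (hlam : 2 < lam) (hxi : 0 ≤ xi) (hfix : quadP lam xi = xi) :
    Set.InjOn (combStep xi) {t | 0 < t.im} := fun _ ha _ hb h =>
  sinScale_injOn (one_le_sqrt_half hlam hxi hfix) ha hb (mul_left_cancel₀ two_ne_zero h)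

theorem differentiableAt_combStep (hlam : 2 < lam) (hxi : 0 ≤ xi) (hfix : quadP lam xi = xi)
    {t : ℂ} (ht : 0 < t.im) : DifferentiableAt ℂ (combStep xi) t :=
  (differentiableAt_sinScale (one_le_sqrt_half hlam hxi hfix) ht).const_mul 2

theorem two_mul_im_le_combStep_im (hlam : 2 < lam) (hxi : 0 ≤ xi) (hfix : quadP lam xi = xi)
    {t : ℂ} (ht : 0 < t.im) : 2 * t.im ≤ (combStep xi t).im := by
  have := im_le_sinScale_im (one_le_sqrt_half hlam hxi hfix) ht
  have e : (combStep xi t).im = 2 * (sinScale (√(xi / 2)) t).im := by simp [combStep]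
  linarith

/-- `L` is bounded on bounded subsets of the upper half-plane. -/
theorem exists_norm_combStep_le (hlam : 2 < lam) (hxi : 0 ≤ xi) (hfix : quadP lam xi = xi)
    (R : ℝ) : ∃ R' : ℝ, ∀ t : ℂ, 0 < t.im → ‖t‖ ≤ R → ‖combStep xi t‖ ≤ R' := by
  have hκ := one_le_sqrt_half hlam hxi hfix
  refine ⟨2 * ((R + Real.pi) + (√(xi / 2) * Real.cosh R + 1)), fun t ht hR => ?_⟩
  have h1 := abs_lt.1 (abs_sinScale_re_sub_lt hκ ht)
  have h2 := sinScale_im_le hκ ht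
  have h3 := Complex.abs_re_le_norm t
  have h4 := Complex.abs_im_le_norm t
  have h5 : |(sinScale (√(xi / 2)) t).re| ≤ R + Real.pi := by
    rw [abs_le] at h3 ⊢
    constructor <;> linarith [h3.1, h3.2]
  have h6 : Real.cosh t.im ≤ Real.cosh R := by
    rw [Real.cosh_le_cosh, abs_of_nonneg (by linarith [norm_nonneg t] : 0 ≤ R)]
    exact h4.trans hR
  have h7 : |(sinScale (√(xi / 2)) t).im| ≤ √(xi / 2) * Real.cosh R + 1 := by
    rw [abs_of_pos (sinScale_im_pos hκ ht)]
    nlinarith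
  have h8 := Complex.norm_le_abs_re_add_abs_im (sinScale (√(xi / 2)) t)
  rw [combStep, norm_mul, Complex.norm_ofNat]
  linarith

/-- The odd slits end at the points where `ξ cos` takes the value `-λ = P(0)`. -/
theorem cosh_slitHeight_odd (hlam : 2 < lam) (hxi : 0 ≤ xi) (hfix : quadP lam xi = xi) {l : ℕ}
    (hl : Odd l) : xi * Real.cosh (Real.pi * slitHeight lam xi l) = lam := by
  have h := slitHeight_odd hlam hxi hfix hl
  simp only [quadP] at h
  linarith

/-- Doubling the position of a slit applies the polynomial to the value of `ξ cosh` at its tip. -/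
theorem cosh_slitHeight_two_mul (hlam : 2 < lam) (hxi : 0 ≤ xi) (hfix : quadP lam xi = xi) {j : ℕ}
    (hj : 1 ≤ j) : xi * Real.cosh (Real.pi * slitHeight lam xi (2 * j)) =
      quadP lam (xi * Real.cosh (Real.pi * slitHeight lam xi j)) := by
  obtain ⟨m, k, hk, rfl⟩ := Nat.exists_eq_two_pow_mul_odd (n := j) (by omega)
  have h1 := slitHeight_even hlam hxi hfix hk (m := m + 1) (by omega)
  rw [show 2 * (2 ^ m * k) = k * 2 ^ (m + 1) by ring, h1, mul_comm (2 ^ m) k,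
    Function.iterate_succ_apply']
  rcases Nat.eq_zero_or_pos m with rfl | hm
  · rw [pow_zero, mul_one, cosh_slitHeight_odd hlam hxi hfix hk]
    simp [quadP]
  · rw [slitHeight_even hlam hxi hfix hk hm]

/-- On a line `Re t = -j π` the cosine is real. -/
theorem cos_of_re_eq {t : ℂ} {j : ℕ} (h : t.re = -(j * Real.pi)) :
    Complex.cos t = ((-1) ^ j * Real.cosh t.im : ℝ) := by
  have hc : Real.cos t.re = (-1) ^ j := by
    rw [h, Real.cos_neg, Real.cos_nat_mul_pi]
  have hs : Real.sin t.re = 0 := by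
    rw [h, Real.sin_neg, Real.sin_nat_mul_pi, neg_zero]
  exact Complex.ext (by rw [Complex.cos_re, hc, Complex.ofReal_re])
    (by rw [Complex.cos_im, hs, Complex.ofReal_im]; ring)

theorem quadP_lt_quadP_iff {a b : ℝ} (ha : 0 ≤ a) (hb : 0 ≤ b) :
    quadP lam a < quadP lam b ↔ a < b := by
  rw [quadP, quadP, sub_lt_sub_iff_right, sq_lt_sq₀ ha hb]

/-- `L` maps the line of the slit at `-j π` into the line of the slit at `-2 j π`, and points above
the first slit are the ones mapped to points above the second. -/
theorem slitHeight_lt_combStep_im_iff (hlam : 2 < lam) (hxi : 0 ≤ xi) (hfix : quadP lam xi = xi)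
    {t : ℂ} (ht : 0 < t.im) {j : ℕ} (hj : 1 ≤ j) (hre : t.re = -(j * Real.pi)) :
    Real.pi * slitHeight lam xi (2 * j) < (combStep xi t).im ↔
      Real.pi * slitHeight lam xi j < t.im := by
  have h2 := two_lt_fixedPoint hlam hxi hfix
  have hpi := Real.pi_pos
  have hre' : (combStep xi t).re = -((2 * j : ℕ) * Real.pi) := by
    have := (combStep_re_lt_iff hlam hxi hfix ht (-(2 * j : ℕ))).2.2 (by rw [hre]; push_cast; ring)
    rw [this]
    push_cast
    ring
  have hc := cos_combStep hlam hxi hfix ht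
  rw [cos_of_re_eq hre', cos_of_re_eq hre, ← Complex.ofReal_mul, ← Complex.ofReal_mul,
    quadP_ofReal, Complex.ofReal_inj] at hc
  have hc' : xi * Real.cosh (combStep xi t).im = quadP lam (xi * Real.cosh t.im) := by
    rw [pow_mul, neg_one_sq, one_pow, one_mul] at hc
    rw [hc, quadP, quadP]
    have : ((-1 : ℝ) ^ j) ^ 2 = 1 := by rw [← pow_mul, mul_comm, pow_mul, neg_one_sq, one_pow]
    linear_combination (xi * Real.cosh t.im) ^ 2 * this
  have hh := cosh_slitHeight_two_mul hlam hxi hfix hj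
  have e1 : Real.pi * slitHeight lam xi (2 * j) < (combStep xi t).im ↔
      xi * Real.cosh (Real.pi * slitHeight lam xi (2 * j)) <
        xi * Real.cosh (combStep xi t).im := by
    rw [mul_lt_mul_iff_right₀ (by linarith), Real.cosh_lt_cosh,
      abs_of_nonneg (mul_nonneg hpi.le (slitHeight_nonneg hlam hxi hfix (by omega))),
      abs_of_pos (combStep_im_pos hlam hxi hfix ht)]
  have e2 : Real.pi * slitHeight lam xi j < t.im ↔
      xi * Real.cosh (Real.pi * slitHeight lam xi j) < xi * Real.cosh t.im := by
    rw [mul_lt_mul_iff_right₀ (by linarith), Real.cosh_lt_cosh,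
      abs_of_nonneg (mul_nonneg hpi.le (slitHeight_nonneg hlam hxi hfix hj)), abs_of_pos ht]
  rw [e1, e2, hh, hc', quadP_lt_quadP_iff]
  · exact mul_nonneg hxi (Real.cosh_pos _).le
  · exact mul_nonneg hxi (Real.cosh_pos _).le

/-- The image of the quadrant under `L` lies off the odd slits. -/
theorem slitHeight_odd_lt_combStep_im (hlam : 2 < lam) (hxi : 0 ≤ xi) (hfix : quadP lam xi = xi)
    {t : ℂ} (ht : 0 < t.im) {l : ℕ} (hl : Odd l) (hre : (combStep xi t).re = -(l * Real.pi)) :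
    Real.pi * slitHeight lam xi l < (combStep xi t).im := by
  have h2 := two_lt_fixedPoint hlam hxi hfix
  have hre' : t.re = -(l * (Real.pi / 2)) := by
    have := (combStep_re_lt_iff hlam hxi hfix ht (-(l : ℤ))).2.1 (by rw [hre]; push_cast; ring)
    rw [this]
    push_cast
    ring
  have hcos : Real.cos t.re = 0 := by
    obtain ⟨i, rfl⟩ := hl
    rw [hre', Real.cos_neg, Real.cos_eq_zero_iff]
    exact ⟨i, by push_cast; ring⟩
  have hsin : Real.sin t.re ^ 2 = 1 := by
    have := Real.sin_sq_add_cos_sq t.re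
    rw [hcos] at this
    linarith
  have hct : Complex.cos t = ((-(Real.sin t.re * Real.sinh t.im) : ℝ) : ℂ) * Complex.I :=
    Complex.ext (by simp [Complex.cos_re, hcos]) 
      (by rw [Complex.cos_im, Complex.im_ofReal_mul, Complex.I_im, mul_one])
  have hc := cos_combStep hlam hxi hfix ht
  have hq : quadP (lam : ℂ) ((xi : ℂ) * Complex.cos t) =
      ((-(xi * Real.sinh t.im) ^ 2 - lam : ℝ) : ℂ) := by
    rw [hct, quadP, mul_pow, mul_pow, Complex.I_sq]
    push_cast
    have : (Real.sin t.re : ℂ) ^ 2 = 1 := by exact_mod_cast hsin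
    push_cast at this
    linear_combination (-(xi : ℂ) ^ 2 * (Complex.sinh t.im) ^ 2) * this
  rw [hq, cos_of_re_eq hre, ← Complex.ofReal_mul, Complex.ofReal_inj, hl.neg_one_pow] at hc
  have hh := cosh_slitHeight_odd hlam hxi hfix hl
  have hlt : Real.cosh (Real.pi * slitHeight lam xi l) < Real.cosh (combStep xi t).im := by
    have h0 := Real.sinh_pos_iff.2 ht
    have : 0 < (xi * Real.sinh t.im) ^ 2 := by positivity
    by_contra hcon
    push Not at hcon
    nlinarith
  rwa [Real.cosh_lt_cosh,
    abs_of_nonneg (mul_nonneg Real.pi_pos.le (slitHeight_nonneg hlam hxi hfix hl.pos)),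
    abs_of_pos (combStep_im_pos hlam hxi hfix ht)] at hlt

/-- The comb is completely invariant under `L`. -/
theorem combStep_mem_scaledComb_iff (hlam : 2 < lam) (hxi : 0 ≤ xi) (hfix : quadP lam xi = xi)
    {t : ℂ} (ht : 0 < t.im) : combStep xi t ∈ scaledComb lam xi ↔ t ∈ scaledComb lam xi := by
  have hline : ∀ j : ℕ, (combStep xi t).re = -((2 * j : ℕ) * Real.pi) ↔
      t.re = -(j * Real.pi) := by
    intro j
    have := (combStep_re_lt_iff hlam hxi hfix ht (-(2 * j : ℕ))).2
    rw [show -((2 * j : ℕ) * Real.pi) = ((-(2 * j : ℕ) : ℤ) : ℝ) * Real.pi by push_cast; ring, this]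
    rw [show ((-(2 * j : ℕ) : ℤ) : ℝ) * (Real.pi / 2) = -(j * Real.pi) by push_cast; ring]
  constructor
  · rintro ⟨h1, -, h3⟩
    refine ⟨(combStep_re_neg_iff hlam hxi hfix ht).1 h1, ht, fun j hj hre => ?_⟩
    rw [← slitHeight_lt_combStep_im_iff hlam hxi hfix ht hj hre]
    exact h3 (2 * j) (by omega) ((hline j).2 hre)
  · rintro ⟨h1, -, h3⟩
    refine ⟨(combStep_re_neg_iff hlam hxi hfix ht).2 h1, combStep_im_pos hlam hxi hfix ht,
      fun l hl hre => ?_⟩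
    rcases Nat.even_or_odd' l with ⟨j, rfl | rfl⟩
    · have hre' := (hline j).1 hre
      rw [slitHeight_lt_combStep_im_iff hlam hxi hfix ht (by omega) hre']
      exact h3 j (by omega) hre'
    · exact slitHeight_odd_lt_combStep_im hlam hxi hfix ht ⟨j, rfl⟩ hre

/-- The comb is contained in the image of `L`: that image omits only the odd slits, on which
`sin (t / 2)` takes its values in `[-κ, κ]`. -/
theorem exists_combStep_eq (hlam : 2 < lam) (hxi : 0 ≤ xi) (hfix : quadP lam xi = xi)
    {t : ℂ} (ht : t ∈ scaledComb lam xi) : ∃ s ∈ scaledComb lam xi, combStep xi s = t := by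
  have hκ := one_le_sqrt_half hlam hxi hfix
  have h2 := two_lt_fixedPoint hlam hxi hfix
  obtain ⟨h1, him, h3⟩ := ht
  have him2 : 0 < (t / 2).im := by simpa using him
  obtain ⟨s, hs, hst⟩ := (exists_sinScale_eq_iff hκ him2).2 (by
    intro x hx hsin
    have hre := congrArg Complex.re hsin
    have him' := congrArg Complex.im hsin
    rw [Complex.sin_re, Complex.ofReal_re] at hre
    rw [Complex.sin_im, Complex.ofReal_im, mul_eq_zero] at him'
    have hcos := him'.resolve_right (Real.sinh_pos_iff.2 him2).ne'
    obtain ⟨k, hk⟩ := Real.cos_eq_zero_iff.1 hcos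
    have hk' : t.re = (2 * k + 1) * Real.pi := by
      simp at hk
      linarith
    have hkneg : k < 0 := by
      by_contra hcon
      push Not at hcon
      have : (0 : ℝ) ≤ k := by exact_mod_cast hcon
      have := Real.pi_pos
      nlinarith
    obtain ⟨l, hl⟩ : ∃ l : ℕ, -(2 * k + 1) = l := ⟨(-(2 * k + 1)).toNat, by omega⟩
    have hlodd : Odd l := by
      rw [← Int.odd_coe_nat, ← hl]
      exact ⟨-k - 1, by ring⟩
    have hl' : (l : ℝ) = -(2 * k + 1) := by exact_mod_cast hl.symm
    have habove := h3 l hlodd.pos (by rw [hk', hl']; ring)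
    have hcosh : Real.cosh (Real.pi * slitHeight lam xi l) < Real.cosh t.im := by
      rwa [Real.cosh_lt_cosh, abs_of_pos him,
        abs_of_nonneg (mul_nonneg Real.pi_pos.le (slitHeight_nonneg hlam hxi hfix hlodd.pos))]
    have hh := cosh_slitHeight_odd hlam hxi hfix hlodd
    have hx2 : x ^ 2 ≤ xi / 2 := by
      rw [← Real.sq_sqrt (by linarith : 0 ≤ xi / 2), ← sq_abs]
      gcongr
    have hsq : Real.sin (t / 2).re ^ 2 = 1 := by
      have := Real.sin_sq_add_cos_sq (t / 2).re
      rw [hcos] at this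
      linarith
    have hx2' : Real.cosh (t / 2).im ^ 2 = x ^ 2 := by
      rw [← hre, mul_pow, hsq, one_mul]
    have hdouble : Real.cosh t.im = 2 * Real.cosh (t / 2).im ^ 2 - 1 := by
      have e : t.im = 2 * (t / 2).im := by simp; ring
      rw [e, Real.cosh_two_mul, Real.sinh_sq]
      ring
    rw [quadP] at hfix
    nlinarith)
  have hst' : combStep xi s = t := by
    rw [combStep, hst]
    ring
  refine ⟨s, (combStep_mem_scaledComb_iff hlam hxi hfix hs).1 ?_, hst'⟩
  rw [hst']
  exact ⟨h1, him, h3⟩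

end combStep

/-! ### A branch of the inverse cosine on the upper half-plane -/

/-- The inverse of the cosine from the half-strip `-π < Re t < 0`, `0 < Im t` onto the upper
half-plane. With `m = i cot (t / 2)` one has `m ^ 2 = (cos t + 1) / (cos t - 1)` and
`exp (i t) = (m - 1) / (m + 1)`. -/
noncomputable def stripArccos (c : ℂ) : ℂ :=
  -Complex.I * Complex.log ((((c + 1) / (c - 1)).sqrt - 1) / (((c + 1) / (c - 1)).sqrt + 1))

section stripArccos

variable {c : ℂ}

theorem sub_one_ne_zero_of_im_pos (hc : 0 < c.im) : c - 1 ≠ 0 := by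
  intro h
  have := congrArg Complex.im h
  simp at this
  exact hc.ne' this

theorem div_sub_one_im_neg (hc : 0 < c.im) : ((c + 1) / (c - 1)).im < 0 := by
  have h0 := Complex.normSq_pos.2 (sub_one_ne_zero_of_im_pos hc)
  rw [Complex.div_im, ← sub_div]
  apply div_neg_of_neg_of_pos _ h0
  simp
  nlinarith

theorem stripArccos_root (hc : 0 < c.im) :
    0 < ((c + 1) / (c - 1)).sqrt.re ∧ ((c + 1) / (c - 1)).sqrt.im < 0 :=
  ⟨Complex.re_sqrt_pos (.inr (div_sub_one_im_neg hc).ne),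
    Complex.im_sqrt_neg (div_sub_one_im_neg hc)⟩

theorem add_one_ne_zero_of_re_pos {m : ℂ} (hm : 0 < m.re) : m + 1 ≠ 0 := by
  intro h
  have := congrArg Complex.re h
  simp at this
  linarith

theorem cayley_im_neg {m : ℂ} (hm : 0 < m.re) (him : m.im < 0) : ((m - 1) / (m + 1)).im < 0 := by
  have h0 := Complex.normSq_pos.2 (add_one_ne_zero_of_re_pos hm)
  rw [Complex.div_im, ← sub_div]
  apply div_neg_of_neg_of_pos _ h0
  simp
  nlinarith

theorem norm_cayley_lt_one {m : ℂ} (hm : 0 < m.re) : ‖(m - 1) / (m + 1)‖ < 1 := by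
  rw [norm_div, div_lt_one (norm_pos_iff.2 (add_one_ne_zero_of_re_pos hm)),
    ← sq_lt_sq₀ (norm_nonneg _) (norm_nonneg _),
    ← Complex.normSq_eq_norm_sq, ← Complex.normSq_eq_norm_sq, Complex.normSq_apply,
    Complex.normSq_apply]
  simp
  nlinarith

theorem stripArccos_im_pos (hc : 0 < c.im) : 0 < (stripArccos c).im := by
  obtain ⟨h1, h2⟩ := stripArccos_root hc
  have h3 := cayley_im_neg h1 h2
  have h4 := norm_cayley_lt_one h1
  have h5 : (((c + 1) / (c - 1)).sqrt - 1) / (((c + 1) / (c - 1)).sqrt + 1) ≠ 0 := by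
    intro h
    rw [h] at h3
    simp at h3
  have : (stripArccos c).im = -Real.log ‖(((c + 1) / (c - 1)).sqrt - 1) /
      (((c + 1) / (c - 1)).sqrt + 1)‖ := by
    rw [stripArccos, ← Complex.log_re]
    simp
  rw [this, neg_pos]
  exact Real.log_neg (norm_pos_iff.2 h5) h4

theorem stripArccos_re (hc : 0 < c.im) :
    -Real.pi < (stripArccos c).re ∧ (stripArccos c).re < 0 := by
  obtain ⟨h1, h2⟩ := stripArccos_root hc
  have h3 := cayley_im_neg h1 h2
  have : (stripArccos c).re = Complex.arg ((((c + 1) / (c - 1)).sqrt - 1) /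
      (((c + 1) / (c - 1)).sqrt + 1)) := by
    rw [stripArccos, ← Complex.log_im]
    simp
  rw [this]
  exact ⟨Complex.neg_pi_lt_arg _, Complex.arg_neg_iff.2 h3⟩

theorem cos_stripArccos (hc : 0 < c.im) : Complex.cos (stripArccos c) = c := by
  obtain ⟨h1, h2⟩ := stripArccos_root hc
  have h3 := cayley_im_neg h1 h2
  have hc1 := sub_one_ne_zero_of_im_pos hc
  have hsq := Complex.sq_sqrt ((c + 1) / (c - 1))
  have hm := add_one_ne_zero_of_re_pos h1
  rw [Complex.cos, stripArccos]
  set m := ((c + 1) / (c - 1)).sqrt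
  have hm' : m - 1 ≠ 0 := by
    intro h
    rw [h] at h3
    simp at h3
  have e1 : -Complex.I * Complex.log ((m - 1) / (m + 1)) * Complex.I =
      Complex.log ((m - 1) / (m + 1)) := by
    linear_combination (-Complex.log ((m - 1) / (m + 1))) * Complex.I_sq
  rw [neg_mul _ Complex.I, e1, Complex.exp_neg, Complex.exp_log (div_ne_zero hm' hm)]
  field_simp at hsq ⊢
  linear_combination -2 * hsq

theorem differentiableAt_stripArccos (hc : 0 < c.im) : DifferentiableAt ℂ stripArccos c := by
  obtain ⟨h1, h2⟩ := stripArccos_root hc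
  have h3 := cayley_im_neg h1 h2
  have hd : DifferentiableAt ℂ (fun c : ℂ => ((c + 1) / (c - 1)).sqrt) c :=
    DifferentiableAt.complexSqrt (by fun_prop (disch := exact sub_one_ne_zero_of_im_pos hc))
      (.inr (div_sub_one_im_neg hc).ne)
  exact (((hd.sub_const 1).div (hd.add_const 1) (add_one_ne_zero_of_re_pos h1)).clog
    (.inr h3.ne)).const_mul _

theorem tendsto_stripArccos : Tendsto stripArccos (𝓝[{c | 0 < c.im}] 1) (𝓝 0) := by
  have hinv : Tendsto (fun c : ℂ => (((c + 1) / (c - 1)).sqrt)⁻¹) (𝓝[{c | 0 < c.im}] 1) (𝓝 0) := by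
    rw [tendsto_zero_iff_norm_tendsto_zero]
    have h1 : Tendsto (fun c : ℂ => √‖(c - 1) / (c + 1)‖) (𝓝 1) (𝓝 0) := by
      have : ContinuousAt (fun c : ℂ => √‖(c - 1) / (c + 1)‖) 1 := by
        refine ContinuousAt.sqrt (ContinuousAt.norm ?_)
        exact ContinuousAt.div (by fun_prop) (by fun_prop) (by norm_num)
      simpa [ContinuousAt] using this
    refine (h1.mono_left nhdsWithin_le_nhds).congr fun c => ?_
    rw [← Real.sqrt_sq (norm_nonneg (((c + 1) / (c - 1)).sqrt)⁻¹), ← norm_pow, inv_pow,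
      Complex.sq_sqrt, inv_div]
  have hq : Tendsto (fun c : ℂ => -Complex.I * Complex.log
      ((1 - (((c + 1) / (c - 1)).sqrt)⁻¹) / (1 + (((c + 1) / (c - 1)).sqrt)⁻¹)))
      (𝓝[{c | 0 < c.im}] 1) (𝓝 0) := by
    have : ContinuousAt (fun x : ℂ => -Complex.I * Complex.log ((1 - x) / (1 + x))) 0 := by
      refine ContinuousAt.mul continuousAt_const (ContinuousAt.clog ?_ (by simp))
      exact ContinuousAt.div (by fun_prop) (by fun_prop) (by norm_num)
    have h := this.tendsto.comp hinv
    simpa [Function.comp_def] using h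
  refine hq.congr' ?_
  filter_upwards [self_mem_nhdsWithin] with c hc
  have h1 := (stripArccos_root hc).1
  have hm : ((c + 1) / (c - 1)).sqrt ≠ 0 := by
    intro h
    rw [h] at h1
    simp at h1
  have hm1 := add_one_ne_zero_of_re_pos h1
  rw [stripArccos]
  congr 2
  field_simp

end stripArccos

/-! ### Backward orbits in the comb -/

section backward

variable {lam xi : ℝ}

theorem combStep_iterate_im_pos (hlam : 2 < lam) (hxi : 0 ≤ xi) (hfix : quadP lam xi = xi) {t : ℂ}
    (ht : 0 < t.im) (n : ℕ) : 0 < ((combStep xi)^[n] t).im := by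
  induction n with
  | zero => exact ht
  | succ n ih =>
    rw [Function.iterate_succ_apply']
    exact combStep_im_pos hlam hxi hfix ih

theorem cos_combStep_iterate (hlam : 2 < lam) (hxi : 0 ≤ xi) (hfix : quadP lam xi = xi) {t : ℂ}
    (ht : 0 < t.im) (n : ℕ) : (xi : ℂ) * Complex.cos ((combStep xi)^[n] t) =
      (quadP (lam : ℂ))^[n] ((xi : ℂ) * Complex.cos t) := by
  induction n with
  | zero => rfl
  | succ n ih =>
    rw [Function.iterate_succ_apply', Function.iterate_succ_apply',
      cos_combStep hlam hxi hfix (combStep_iterate_im_pos hlam hxi hfix ht n), ih]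

theorem combStep_iterate_mem_scaledComb_iff (hlam : 2 < lam) (hxi : 0 ≤ xi)
    (hfix : quadP lam xi = xi) {t : ℂ} (ht : 0 < t.im) (n : ℕ) :
    (combStep xi)^[n] t ∈ scaledComb lam xi ↔ t ∈ scaledComb lam xi := by
  induction n with
  | zero => rfl
  | succ n ih =>
    rw [Function.iterate_succ_apply', combStep_mem_scaledComb_iff hlam hxi hfix
      (combStep_iterate_im_pos hlam hxi hfix ht n), ih]

theorem combStep_iterate_injOn (hlam : 2 < lam) (hxi : 0 ≤ xi) (hfix : quadP lam xi = xi) (n : ℕ) :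
    Set.InjOn ((combStep xi)^[n]) {t | 0 < t.im} := by
  induction n with
  | zero => exact Set.injOn_id _
  | succ n ih =>
    intro a ha b hb hab
    rw [Function.iterate_succ_apply', Function.iterate_succ_apply'] at hab
    exact ih ha hb (combStep_injOn hlam hxi hfix (combStep_iterate_im_pos hlam hxi hfix ha n)
      (combStep_iterate_im_pos hlam hxi hfix hb n) hab)

theorem differentiableAt_combStep_iterate (hlam : 2 < lam) (hxi : 0 ≤ xi)
    (hfix : quadP lam xi = xi) {t : ℂ} (ht : 0 < t.im) (n : ℕ) :
    DifferentiableAt ℂ ((combStep xi)^[n]) t := by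
  induction n with
  | zero => exact differentiableAt_id
  | succ n ih =>
    rw [Function.iterate_succ']
    exact (differentiableAt_combStep hlam hxi hfix
      (combStep_iterate_im_pos hlam hxi hfix ht n)).comp t ih

theorem exists_norm_combStep_iterate_le (hlam : 2 < lam) (hxi : 0 ≤ xi) (hfix : quadP lam xi = xi)
    (R : ℝ) (n : ℕ) :
    ∃ R' : ℝ, ∀ t : ℂ, 0 < t.im → ‖t‖ ≤ R → ‖(combStep xi)^[n] t‖ ≤ R' := by
  induction n with
  | zero => exact ⟨R, fun t _ h => h⟩
  | succ n ih =>
    obtain ⟨R₁, h₁⟩ := ih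
    obtain ⟨R₂, h₂⟩ := exists_norm_combStep_le hlam hxi hfix R₁
    refine ⟨R₂, fun t ht hR => ?_⟩
    rw [Function.iterate_succ_apply']
    exact h₂ _ (combStep_iterate_im_pos hlam hxi hfix ht n) (h₁ t ht hR)

theorem two_pow_mul_im_le (hlam : 2 < lam) (hxi : 0 ≤ xi) (hfix : quadP lam xi = xi)
    {t : ℂ} (ht : 0 < t.im) (n : ℕ) : 2 ^ n * t.im ≤ ((combStep xi)^[n] t).im := by
  induction n with
  | zero => simp
  | succ n ih =>
    rw [Function.iterate_succ_apply']
    have := two_mul_im_le_combStep_im hlam hxi hfix (combStep_iterate_im_pos hlam hxi hfix ht n)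
    rw [pow_succ]
    linarith

theorem neg_int_le_re_of_combStep (hlam : 2 < lam) (hxi : 0 ≤ xi) (hfix : quadP lam xi = xi)
    {s : ℂ} (hs : 0 < s.im) (k : ℕ) (h : -(k * Real.pi) ≤ (combStep xi s).re) :
    -(k * (Real.pi / 2)) ≤ s.re := by
  have := (combStep_re_lt_iff hlam hxi hfix hs (-(k : ℤ))).1
  push_cast at this
  by_contra hcon
  push Not at hcon
  have := this.2 (by linarith)
  linarith

/-- Each backward step halves the distance of the strip to the imaginary axis, until the backward
orbit enters the half-strip `-π / 2 ≤ Re s < 0`. -/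
theorem neg_half_pi_le_re_of_iterate (hlam : 2 < lam) (hxi : 0 ≤ xi) (hfix : quadP lam xi = xi)
    {s : ℂ} (hs : 0 < s.im) (m : ℕ)
    (h : -(2 ^ m * Real.pi) ≤ ((combStep xi)^[m + 1] s).re) : -(Real.pi / 2) ≤ s.re := by
  induction m with
  | zero =>
    have := neg_int_le_re_of_combStep hlam hxi hfix hs 1 (by simpa using h)
    simpa using this
  | succ m ih =>
    rw [Function.iterate_succ_apply'] at h
    have := neg_int_le_re_of_combStep hlam hxi hfix
      (combStep_iterate_im_pos hlam hxi hfix hs (m + 1)) (2 ^ (m + 1)) (by exact_mod_cast h)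
    push_cast at this
    apply ih
    rw [pow_succ] at this
    linarith

/-- Backward orbits under the polynomial stay bounded. -/
theorem norm_cos_le_of_iterate (hlam : 2 < lam) (hxi : 0 ≤ xi) (hfix : quadP lam xi = xi)
    {s : ℂ} (hs : 0 < s.im) {M : ℝ} (hM : xi ≤ M) (n : ℕ)
    (h : ‖(xi : ℂ) * Complex.cos ((combStep xi)^[n] s)‖ ≤ M) : ‖(xi : ℂ) * Complex.cos s‖ ≤ M := by
  have h2 := two_lt_fixedPoint hlam hxi hfix
  induction n with
  | zero => exact h
  | succ n ih =>
    apply ih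
    have hs' := combStep_iterate_im_pos hlam hxi hfix hs n
    rw [Function.iterate_succ_apply', cos_combStep hlam hxi hfix hs', quadP] at h
    set u := (xi : ℂ) * Complex.cos ((combStep xi)^[n] s)
    have h3 : ‖u‖ ^ 2 ≤ M + lam := by
      rw [← norm_pow]
      have := norm_sub_norm_le (u ^ 2) (lam : ℂ)
      rw [Complex.norm_real, Real.norm_eq_abs, abs_of_pos (by linarith)] at this
      linarith
    rw [quadP] at hfix
    have h4 : ‖u‖ ^ 2 ≤ M ^ 2 := by nlinarith
    exact (sq_le_sq₀ (norm_nonneg _) (by linarith)).1 h4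

/-- On the half-strip `-π / 2 ≤ Re s < 0` the backward orbits converge geometrically to the
fixed point: there the inverse branch of the polynomial is the principal square root. -/
theorem norm_cos_sub_le_of_iterate (hlam : 2 < lam) (hxi : 0 ≤ xi) (hfix : quadP lam xi = xi)
    (n : ℕ) : ∀ {s : ℂ}, 0 < s.im → s.re < 0 → -(Real.pi / 2) ≤ ((combStep xi)^[n] s).re →
      -(Real.pi / 2) ≤ s.re ∧ xi ^ n * ‖(xi : ℂ) * Complex.cos s - xi‖ ≤
        ‖(xi : ℂ) * Complex.cos ((combStep xi)^[n] s) - xi‖ := by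
  have h2 := two_lt_fixedPoint hlam hxi hfix
  have hpi := Real.pi_pos
  induction n with
  | zero =>
    intro s hs hre h
    exact ⟨h, by simp⟩
  | succ n ih =>
    intro s hs hre h
    rw [Function.iterate_succ_apply] at h ⊢
    obtain ⟨h3, h4⟩ := ih (combStep_im_pos hlam hxi hfix hs)
      ((combStep_re_neg_iff hlam hxi hfix hs).2 hre) h
    have h5 : -(Real.pi / 2) ≤ s.re := by
      have := neg_int_le_re_of_combStep hlam hxi hfix hs 1 (by push_cast; linarith)
      push_cast at this
      linarith
    refine ⟨h5, le_trans ?_ h4⟩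
    rw [cos_combStep hlam hxi hfix hs, pow_succ, mul_assoc]
    gcongr
    have hcre : 0 ≤ (Complex.cos s).re := by
      rw [Complex.cos_re]
      exact mul_nonneg (Real.cos_nonneg_of_neg_pi_div_two_le_of_le (by linarith) (by linarith))
        (Real.cosh_pos _).le
    have hfac : quadP (lam : ℂ) ((xi : ℂ) * Complex.cos s) - xi =
        ((xi : ℂ) * Complex.cos s + xi) * ((xi : ℂ) * Complex.cos s - xi) := by
      have hl : (lam : ℂ) = xi ^ 2 - xi := by
        rw [quadP] at hfix
        rw [← Complex.ofReal_pow, ← Complex.ofReal_sub]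
        congr 1
        linarith
      rw [quadP, hl]
      ring
    rw [hfac, norm_mul]
    gcongr
    refine le_trans ?_ (Complex.re_le_norm _)
    simp only [Complex.add_re, Complex.re_ofReal_mul, Complex.ofReal_re]
    nlinarith

theorem exists_combStep_iterate_eq (hlam : 2 < lam) (hxi : 0 ≤ xi) (hfix : quadP lam xi = xi)
    (n : ℕ) : ∀ {t : ℂ}, t ∈ scaledComb lam xi →
      ∃ s ∈ scaledComb lam xi, (combStep xi)^[n] s = t := by
  induction n with
  | zero => exact fun {t} ht => ⟨t, ht, rfl⟩
  | succ n ih =>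
    intro t ht
    obtain ⟨s, hs, hst⟩ := exists_combStep_eq hlam hxi hfix ht
    obtain ⟨s', hs', hst'⟩ := ih hs
    exact ⟨s', hs', by rw [Function.iterate_succ_apply', hst', hst]⟩

/-- Every point of the comb has backward orbits along which `ξ cos` tends to the fixed point,
uniformly on bounded sets. -/
theorem exists_backward_orbit (hlam : 2 < lam) (hxi : 0 ≤ xi) (hfix : quadP lam xi = xi)
    (R : ℝ) {δ : ℝ} (hδ : 0 < δ) : ∃ n : ℕ, ∀ t ∈ scaledComb lam xi, ‖t‖ ≤ R →
      ∃ s ∈ scaledComb lam xi, (combStep xi)^[n] s = t ∧ -(Real.pi / 2) ≤ s.re ∧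
        ‖(xi : ℂ) * Complex.cos s - xi‖ < δ := by
  have h2 := two_lt_fixedPoint hlam hxi hfix
  have hpi := Real.pi_pos
  obtain ⟨M₀, hM₀⟩ := (isCompact_closedBall (0 : ℂ) R).exists_bound_of_continuousOn
    (f := fun t => (xi : ℂ) * Complex.cos t) (by fun_prop)
  obtain ⟨m, hm⟩ : ∃ m : ℕ, R ≤ 2 ^ m * Real.pi := by
    obtain ⟨m, hm⟩ := pow_unbounded_of_one_lt (R / Real.pi) (one_lt_two)
    exact ⟨m, by rw [div_lt_iff₀ hpi] at hm; exact hm.le⟩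
  set M := max xi M₀ with hM
  obtain ⟨n, hn⟩ : ∃ n : ℕ, (M + xi) / δ < xi ^ n := pow_unbounded_of_one_lt _ (by linarith)
  refine ⟨(m + 1) + n, fun t ht htR => ?_⟩
  obtain ⟨s, hs, hst⟩ := exists_combStep_iterate_eq hlam hxi hfix ((m + 1) + n) ht
  refine ⟨s, hs, hst, ?_⟩
  rw [Function.iterate_add_apply] at hst
  have hs1 := combStep_iterate_im_pos hlam hxi hfix hs.2.1 n
  have hre1 := neg_half_pi_le_re_of_iterate hlam hxi hfix hs1 m (by
    rw [hst]
    have := abs_le.1 ((Complex.abs_re_le_norm t).trans htR)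
    linarith [this.1])
  have hb := norm_cos_le_of_iterate hlam hxi hfix hs1 (le_max_left xi M₀) (m + 1) (by
    rw [hst]
    exact (hM₀ t (by simpa using htR)).trans (le_max_right _ _))
  obtain ⟨h3, h4⟩ := norm_cos_sub_le_of_iterate hlam hxi hfix n hs.2.1 hs.1 hre1
  refine ⟨h3, ?_⟩
  have h5 := norm_sub_le ((xi : ℂ) * Complex.cos ((combStep xi)^[n] s)) (xi : ℂ)
  rw [Complex.norm_real, Real.norm_eq_abs, abs_of_pos (by linarith)] at h5
  rw [div_lt_iff₀ hδ] at hn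
  have h6 : 0 < xi ^ n := by positivity
  by_contra hcon
  push Not at hcon
  nlinarith

end backward

/-! ### The Poincaré function -/

/-- The Taylor coefficients at `0` of the solution of `f(ρ z) = f(z) ^ 2 + ρ f(z)`. -/
noncomputable def poincareCoeff (ρ : ℝ) : ℕ → ℝ
  | 0 => 0
  | 1 => 1
  | n + 2 => (∑ k : Fin (n + 1), poincareCoeff ρ (k + 1) * poincareCoeff ρ (n + 1 - k)) /
      (ρ ^ (n + 2) - ρ)

theorem two_pow_le_pow_sub {ρ : ℝ} (hρ : 4 ≤ ρ) (n : ℕ) : 2 ^ (n + 2) ≤ ρ ^ (n + 2) - ρ := by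
  have h1 : (4 : ℝ) ^ (n + 1) ≤ ρ ^ (n + 1) := by gcongr
  have h2 : (2 : ℝ) ^ (n + 1) ≤ 4 ^ (n + 1) := by gcongr; norm_num
  have h3 : (2 : ℝ) ≤ 2 ^ (n + 1) := by
    rw [pow_succ]
    linarith [one_le_pow₀ (n := n) (one_le_two (α := ℝ))]
  rw [pow_succ 2 (n + 1), pow_succ ρ (n + 1)]
  nlinarith

theorem poincareCoeff_conv {ρ : ℝ} (hρ : 4 ≤ ρ) (n : ℕ) :
    ∑ k ∈ Finset.range (n + 1), poincareCoeff ρ k * poincareCoeff ρ (n - k) =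
      (ρ ^ n - ρ) * poincareCoeff ρ n := by
  match n with
  | 0 => simp [poincareCoeff]
  | 1 => simp [Finset.sum_range_succ, poincareCoeff]
  | n + 2 =>
    have hpos : 0 < ρ ^ (n + 2) - ρ := lt_of_lt_of_le (by positivity) (two_pow_le_pow_sub hρ n)
    have h0 : poincareCoeff ρ 0 = 0 := by rw [poincareCoeff]
    rw [Finset.sum_range_succ, Finset.sum_range_succ', Nat.sub_self, h0, mul_zero, zero_mul,
      add_zero, add_zero]
    conv_rhs => rw [poincareCoeff]
    rw [mul_div_cancel₀ _ hpos.ne', Finset.sum_range]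
    refine Finset.sum_congr rfl fun k _ => ?_
    congr 2
    omega

/-- The bound `1 / n!` reproduces itself in the recursion since the sum of the binomial coefficients
of order `n` is `2 ^ n`, which is at most `ρ ^ n - ρ` for `n ≥ 2`. -/
theorem abs_poincareCoeff_le {ρ : ℝ} (hρ : 4 ≤ ρ) (n : ℕ) :
    |poincareCoeff ρ n| ≤ 1 / (n.factorial : ℝ) := by
  induction n using Nat.strong_induction_on with
  | _ n ih =>
  match n with
  | 0 => simp [poincareCoeff]
  | 1 => simp [poincareCoeff]
  | n + 2 =>
    have hpow := two_pow_le_pow_sub hρ n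
    have hpos : 0 < ρ ^ (n + 2) - ρ := lt_of_lt_of_le (by positivity) hpow
    have hfac : (0 : ℝ) < ((n + 2).factorial : ℝ) := by positivity
    rw [poincareCoeff, abs_div, abs_of_pos hpos, div_le_iff₀ hpos]
    calc |∑ k : Fin (n + 1), poincareCoeff ρ (k + 1) * poincareCoeff ρ (n + 1 - k)|
        ≤ ∑ k : Fin (n + 1), |poincareCoeff ρ (k + 1) * poincareCoeff ρ (n + 1 - k)| :=
          Finset.abs_sum_le_sum_abs _ _
      _ ≤ ∑ k : Fin (n + 1), ((n + 2).choose (k + 1) : ℝ) / (n + 2).factorial := by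
          refine Finset.sum_le_sum fun k _ => ?_
          have hk := k.2
          rw [Nat.cast_choose ℝ (by omega : (k : ℕ) + 1 ≤ n + 2), abs_mul,
            show n + 2 - ((k : ℕ) + 1) = n + 1 - k by omega, div_div_cancel_left' hfac.ne',
            mul_inv, ← one_div, ← one_div]
          exact mul_le_mul (ih _ (by omega)) (ih _ (by omega)) (abs_nonneg _) (by positivity)
      _ = (∑ k ∈ Finset.range (n + 1), ((n + 2).choose (k + 1) : ℝ)) / (n + 2).factorial := by
          rw [Finset.sum_range, Finset.sum_div]
      _ ≤ 2 ^ (n + 2) / (n + 2).factorial := by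
          gcongr
          have h := Nat.sum_range_choose (n + 2)
          rw [Finset.sum_range_succ, Finset.sum_range_succ'] at h
          have : ∑ k ∈ Finset.range (n + 1), (n + 2).choose (k + 1) ≤ 2 ^ (n + 2) := by omega
          exact_mod_cast this
      _ ≤ 1 / (n + 2).factorial * (ρ ^ (n + 2) - ρ) := by
          rw [one_div_mul_eq_div]
          gcongr

section poincare

variable {lam xi : ℝ}

theorem summable_poincareCoeff {ρ : ℝ} (hρ : 4 ≤ ρ) (z : ℂ) :
    Summable fun n => ‖(poincareCoeff ρ n : ℂ) * z ^ n‖ := by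
  refine Summable.of_nonneg_of_le (fun _ => norm_nonneg _) (fun n => ?_)
    (Real.summable_pow_div_factorial ‖z‖)
  rw [norm_mul, norm_pow, Complex.norm_real, Real.norm_eq_abs, div_eq_inv_mul, ← one_div]
  gcongr
  exact abs_poincareCoeff_le hρ n

theorem quadPHat_eq (hfix : quadP lam xi = xi) (z : ℂ) :
    quadPHat (lam : ℂ) (xi : ℂ) z = z * z + 2 * xi * z := by
  have hl : (lam : ℂ) = xi ^ 2 - xi := by
    rw [quadP] at hfix
    rw [← Complex.ofReal_pow, ← Complex.ofReal_sub]
    congr 1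
    linarith
  rw [quadPHat, quadP, hl]
  ring

theorem exists_isPoincareFunction (hlam : 2 < lam) (hxi : 0 ≤ xi) (hfix : quadP lam xi = xi) :
    ∃ F : ℂ → ℂ, IsPoincareFunction lam xi F := by
  have h2 := two_lt_fixedPoint hlam hxi hfix
  have hρ : 4 ≤ 2 * xi := by linarith
  set a : ℕ → ℂ := fun n => (poincareCoeff (2 * xi) n : ℂ) with ha
  set p : FormalMultilinearSeries ℂ ℂ ℂ := FormalMultilinearSeries.ofScalars ℂ a with hp
  have hrad : p.radius = ⊤ := by
    refine FormalMultilinearSeries.radius_eq_top_of_summable_norm p fun r => ?_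
    refine (summable_poincareCoeff hρ (r : ℂ)).congr fun n => ?_
    rw [hp, FormalMultilinearSeries.ofScalars_norm, norm_mul, norm_pow]
    simp [ha]
  have hps : HasFPowerSeriesOnBall p.sum p 0 ⊤ := by
    rw [← hrad]
    exact p.hasFPowerSeriesOnBall (by rw [hrad]; exact ENNReal.zero_lt_top)
  have hsum : ∀ z, p.sum z = ∑' n, a n * z ^ n := by
    intro z
    have := FormalMultilinearSeries.ofScalars_sum_eq (E := ℂ) a z
    simpa [FormalMultilinearSeries.ofScalarsSum, hp] using this
  refine ⟨p.sum, ?_, ?_, ?_, ?_⟩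
  · rw [← differentiableOn_univ]
    have := hps.differentiableOn
    rwa [Metric.eball_top] at this
  · intro z
    have hs := summable_poincareCoeff hρ z
    rw [quadPHat_eq hfix, hsum, hsum, tsum_mul_tsum_eq_tsum_sum_range_of_summable_norm hs hs,
      ← tsum_mul_left, ← Summable.tsum_add]
    · refine tsum_congr fun n => ?_
      have hc : ∑ k ∈ Finset.range (n + 1), a k * a (n - k) =
          ((2 * xi : ℂ) ^ n - 2 * xi) * a n := by
        have := congrArg Complex.ofReal (poincareCoeff_conv hρ n)
        push_cast at this
        simpa [ha] using this
      have : ∑ k ∈ Finset.range (n + 1), a k * z ^ k * (a (n - k) * z ^ (n - k)) =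
          (∑ k ∈ Finset.range (n + 1), a k * a (n - k)) * z ^ n := by
        rw [Finset.sum_mul]
        refine Finset.sum_congr rfl fun k hk => ?_
        have : z ^ n = z ^ k * z ^ (n - k) := by
          rw [← pow_add]
          congr 1
          have := Finset.mem_range.1 hk
          omega
        rw [this]
        ring
      rw [this, hc, mul_pow]
      ring
    · exact (summable_norm_sum_mul_range_of_summable_norm hs hs).of_norm
    · exact hs.of_norm.mul_left _
  · rw [hsum, tsum_eq_single 0]
    · simp [ha, poincareCoeff]
    · intro n hn
      simp [hn]
  · have := hps.hasFPowerSeriesAt.hasDerivAt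
    simpa [hp, ha, FormalMultilinearSeries.ofScalars, poincareCoeff] using this

/-- Uniqueness: the difference `d` of two solutions satisfies `d(ρ z) = d(z) (ρ + o(1))`, so it
vanishes at `0` to first order if it is not zero, which the normalization excludes. -/
theorem IsPoincareFunction.eq (hlam : 2 < lam) (hxi : 0 ≤ xi) (hfix : quadP lam xi = xi)
    {F G : ℂ → ℂ} (hF : IsPoincareFunction lam xi F) (hG : IsPoincareFunction lam xi G) :
    F = G := by
  have h2 := two_lt_fixedPoint hlam hxi hfix
  have hρ0 : (2 * xi : ℂ) ≠ 0 := by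
    exact_mod_cast (by linarith : 2 * xi ≠ 0)
  have hFa : AnalyticOnNhd ℂ F Set.univ := fun z _ => hF.entire.analyticAt z
  have hGa : AnalyticOnNhd ℂ G Set.univ := fun z _ => hG.entire.analyticAt z
  by_contra hne
  have hnz : ¬ ∀ᶠ z in 𝓝 (0 : ℂ), (F - G) z = 0 := by
    intro h
    refine hne (AnalyticOnNhd.eq_of_eventuallyEq (z₀ := 0) hFa hGa ?_)
    filter_upwards [h] with z hz
    exact sub_eq_zero.1 hz
  obtain ⟨n, g, hg, hg0, heq⟩ := (((hFa 0 trivial).sub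
    (hGa 0 trivial)).exists_eventuallyEq_pow_smul_nonzero_iff).2 hnz
  simp only [sub_zero, smul_eq_mul, Pi.sub_apply] at heq
  have hlin : Tendsto (fun z : ℂ => (2 * xi : ℂ) * z) (𝓝 0) (𝓝 0) := by
    have : Continuous (fun z : ℂ => (2 * xi : ℂ) * z) := by fun_prop
    simpa using this.tendsto 0
  have hkey : ∀ᶠ z in 𝓝[≠] (0 : ℂ), (2 * xi : ℂ) ^ n * g ((2 * xi : ℂ) * z) =
      g z * (F z + G z + 2 * xi) := by
    filter_upwards [heq.filter_mono nhdsWithin_le_nhds,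
      (hlin.eventually heq).filter_mono nhdsWithin_le_nhds, self_mem_nhdsWithin] with z h1 h3 hz
    have hz' : z ^ n ≠ 0 := pow_ne_zero _ hz
    rw [← hF.equation, ← hG.equation, quadPHat_eq hfix, quadPHat_eq hfix, mul_pow] at h3
    apply mul_left_cancel₀ hz'
    linear_combination -h3 + (F z + G z + 2 * xi) * h1
  have hl1 : Tendsto (fun z => (2 * xi : ℂ) ^ n * g ((2 * xi : ℂ) * z)) (𝓝[≠] 0)
      (𝓝 ((2 * xi : ℂ) ^ n * g 0)) :=
    ((hg.continuousAt.tendsto.comp hlin).const_mul _).mono_left nhdsWithin_le_nhds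
  have hl2 : Tendsto (fun z => g z * (F z + G z + 2 * xi)) (𝓝[≠] 0)
      (𝓝 (g 0 * (F 0 + G 0 + 2 * xi))) :=
    (hg.continuousAt.tendsto.mul (((hF.entire.continuous.tendsto 0).add
      (hG.entire.continuous.tendsto 0)).add_const _)).mono_left nhdsWithin_le_nhds
  have hlim := tendsto_nhds_unique (hl1.congr' hkey) hl2
  rw [hF.map_zero, hG.map_zero, add_zero, zero_add, mul_comm] at hlim
  have hpow : (2 * xi : ℂ) ^ n = 2 * xi := mul_left_cancel₀ hg0 hlim
  have hn : n = 1 := by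
    have h3 : (2 * xi) ^ n = (2 * xi) ^ 1 := by
      rw [pow_one]
      exact_mod_cast hpow
    exact pow_right_injective₀ (by linarith) (by linarith) h3
  subst hn
  have hd1 : HasDerivAt (fun z => F z - G z) (1 - 1) 0 := hF.deriv_zero.sub hG.deriv_zero
  have hd2 : HasDerivAt (fun z => z ^ 1 * g z) (g 0) 0 := by
    have := (hasDerivAt_id' (0 : ℂ)).fun_mul hg.differentiableAt.hasDerivAt
    simpa using this
  have := (hd2.congr_of_eventuallyEq heq).unique hd1
  rw [sub_self] at this
  exact hg0 this

/-- By uniqueness, the Poincaré function commutes with complex conjugation. -/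
theorem IsPoincareFunction.conj (hlam : 2 < lam) (hxi : 0 ≤ xi) (hfix : quadP lam xi = xi)
    {F : ℂ → ℂ} (hF : IsPoincareFunction lam xi F) (z : ℂ) :
    F ((starRingEnd ℂ) z) = (starRingEnd ℂ) (F z) := by
  have hG : IsPoincareFunction lam xi (⇑(starRingEnd ℂ) ∘ F ∘ ⇑(starRingEnd ℂ)) := by
    refine ⟨fun z => ?_, fun z => ?_, ?_, ?_⟩
    · have := (hF.entire ((starRingEnd ℂ) z)).conj_conj
      simpa using this
    · have := congrArg (starRingEnd ℂ) (hF.equation ((starRingEnd ℂ) z))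
      rw [quadPHat_eq hfix] at this ⊢
      have h2 : (starRingEnd ℂ) 2 = 2 := map_ofNat _ 2
      simpa [h2] using this
    · simp [hF.map_zero]
    · simpa using hF.deriv_zero.conj_conj
  have := congrFun (hF.eq hlam hxi hfix hG) z
  rw [this]
  simp

end poincare

/-! ### The lift of the Poincaré function through `ξ cos` -/

/-- A radius `r` such that `F` is close to the identity on the disc of radius `r` about `0`. -/
structure IsPoincareRadius (F : ℂ → ℂ) (r : ℝ) : Prop where
  pos : 0 < r
  dist_le : ∀ v w : ℂ, ‖v‖ < r → ‖w‖ < r → ‖F v - F w - (v - w)‖ ≤ 1 / 2 * ‖v - w‖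
  norm_lt_one : ∀ v : ℂ, ‖v‖ < r → ‖F v‖ < 1

/-- The lift of `F + ξ` through `ξ cos`, near `0`. -/
noncomputable def localLift (xi : ℝ) (F : ℂ → ℂ) (v : ℂ) : ℂ := stripArccos (1 + F v / xi)

section lift

variable {lam xi r : ℝ} {F X : ℂ → ℂ} {v w : ℂ}

theorem IsPoincareFunction.exists_radius (hF : IsPoincareFunction lam xi F) :
    ∃ r, IsPoincareRadius F r := by
  have hs : HasStrictDerivAt F 1 0 := by
    have := (hF.entire.analyticAt 0).hasStrictDerivAt
    rwa [hF.deriv_zero.deriv] at this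
  have h1 : ∀ᶠ p : ℂ × ℂ in 𝓝 0, ‖F p.1 - F p.2 - (p.1 - p.2)‖ ≤ 1 / 2 * ‖p.1 - p.2‖ := by
    rw [← Prod.mk_zero_zero]
    have := hs.isLittleO.def (c := 1 / 2) (by norm_num)
    simpa using this
  have h2 : ∀ᶠ v in 𝓝 (0 : ℂ), ‖F v‖ < 1 := by
    have := hF.entire.continuous.norm.tendsto 0
    rw [hF.map_zero, norm_zero] at this
    exact this.eventually_lt_const one_pos
  obtain ⟨r₁, hr₁, h1⟩ := Metric.eventually_nhds_iff.1 h1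
  obtain ⟨r₂, hr₂, h2⟩ := Metric.eventually_nhds_iff.1 h2
  refine ⟨min r₁ r₂, lt_min hr₁ hr₂, fun v w hv hw => ?_, fun v hv => ?_⟩
  · refine h1 (y := (v, w)) ?_
    rw [dist_zero_right, Prod.norm_def]
    exact max_lt (hv.trans_le (min_le_left _ _)) (hw.trans_le (min_le_left _ _))
  · exact h2 (by rw [dist_zero_right]; exact hv.trans_le (min_le_right _ _))

theorem IsPoincareFunction.im_ofReal (hlam : 2 < lam) (hxi : 0 ≤ xi) (hfix : quadP lam xi = xi)
    (hF : IsPoincareFunction lam xi F) (x : ℝ) : (F x).im = 0 := by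
  have := hF.conj hlam hxi hfix x
  rw [Complex.conj_ofReal] at this
  exact Complex.conj_eq_iff_im.1 this.symm

/-- Near `0` the function `F` preserves the upper and the lower half-plane. -/
theorem IsPoincareRadius.im_pos_iff (hlam : 2 < lam) (hxi : 0 ≤ xi) (hfix : quadP lam xi = xi)
    (hF : IsPoincareFunction lam xi F) (hr : IsPoincareRadius F r) (hv : ‖v‖ < r) :
    0 < (F v).im ↔ 0 < v.im := by
  have h1 := hr.dist_le v (v.re : ℂ) hv (by
    rw [Complex.norm_real, Real.norm_eq_abs]
    exact (Complex.abs_re_le_norm v).trans_lt hv)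
  have h2 := (Complex.abs_im_le_norm _).trans h1
  have h3 : ‖v - v.re‖ = |v.im| := by
    have : v - v.re = v.im * Complex.I := by
      apply Complex.ext <;> simp
    rw [this, norm_mul, Complex.norm_I, mul_one, Complex.norm_real, Real.norm_eq_abs]
  rw [h3] at h2
  simp only [Complex.sub_im, Complex.ofReal_im, hF.im_ofReal hlam hxi hfix, sub_zero] at h2
  rw [abs_le] at h2
  constructor
  · intro h
    by_contra hcon
    push Not at hcon
    rw [abs_of_nonpos hcon] at h2
    linarith [h2.2]
  · intro h
    rw [abs_of_pos h] at h2
    linarith [h2.1]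

theorem IsPoincareRadius.injOn (hr : IsPoincareRadius F r) (hv : ‖v‖ < r) (hw : ‖w‖ < r)
    (h : F v = F w) : v = w := by
  have h1 := hr.dist_le v w hv hw
  rw [h, sub_self, zero_sub, norm_neg] at h1
  have : ‖v - w‖ = 0 := by linarith [norm_nonneg (v - w)]
  exact sub_eq_zero.1 (norm_eq_zero.1 this)

theorem IsPoincareFunction.exists_preimage (hF : IsPoincareFunction lam xi F) {ε : ℝ}
    (hε : 0 < ε) : ∃ δ > 0, ∀ z : ℂ, ‖z‖ < δ → ∃ v : ℂ, ‖v‖ < ε ∧ F v = z := by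
  have hs : HasStrictDerivAt F 1 0 := by
    have := (hF.entire.analyticAt 0).hasStrictDerivAt
    rwa [hF.deriv_zero.deriv] at this
  have hmap := hs.map_nhds_eq one_ne_zero
  rw [hF.map_zero] at hmap
  have hmem : F '' Metric.ball 0 ε ∈ 𝓝 (0 : ℂ) := by
    rw [← hmap]
    exact image_mem_map (Metric.ball_mem_nhds 0 hε)
  obtain ⟨δ, hδ, hsub⟩ := Metric.mem_nhds_iff.1 hmem
  refine ⟨δ, hδ, fun z hz => ?_⟩
  obtain ⟨v, hv, rfl⟩ := hsub (by simpa using hz)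
  exact ⟨v, by simpa using hv, rfl⟩

theorem localLift_arg (hlam : 2 < lam) (hxi : 0 ≤ xi) (hfix : quadP lam xi = xi)
    (hF : IsPoincareFunction lam xi F) (hr : IsPoincareRadius F r) (hv : ‖v‖ < r)
    (him : 0 < v.im) : 0 < (1 + F v / xi).im ∧ 0 < (1 + F v / xi).re := by
  have h2 := two_lt_fixedPoint hlam hxi hfix
  have h1 := (hr.im_pos_iff hlam hxi hfix hF hv).2 him
  have h3 := hr.norm_lt_one v hv
  have h4 := neg_le_of_abs_le ((Complex.abs_re_le_norm _).trans h3.le)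
  simp only [Complex.add_im, Complex.one_im, zero_add, Complex.add_re, Complex.one_re,
    Complex.div_ofReal_im, Complex.div_ofReal_re]
  refine ⟨by positivity, ?_⟩
  have : -1 < (F v).re / xi := by
    rw [lt_div_iff₀ (by linarith)]
    linarith
  linarith

theorem cos_localLift (hlam : 2 < lam) (hxi : 0 ≤ xi) (hfix : quadP lam xi = xi)
    (hF : IsPoincareFunction lam xi F) (hr : IsPoincareRadius F r) (hv : ‖v‖ < r)
    (him : 0 < v.im) : (xi : ℂ) * Complex.cos (localLift xi F v) = F v + xi := by
  have h2 := two_lt_fixedPoint hlam hxi hfix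
  have hx : (xi : ℂ) ≠ 0 := by exact_mod_cast (by linarith : xi ≠ 0)
  rw [localLift, cos_stripArccos (localLift_arg hlam hxi hfix hF hr hv him).1]
  field_simp
  ring

theorem localLift_im_pos (hlam : 2 < lam) (hxi : 0 ≤ xi) (hfix : quadP lam xi = xi)
    (hF : IsPoincareFunction lam xi F) (hr : IsPoincareRadius F r) (hv : ‖v‖ < r)
    (him : 0 < v.im) : 0 < (localLift xi F v).im :=
  stripArccos_im_pos (localLift_arg hlam hxi hfix hF hr hv him).1

theorem localLift_re (hlam : 2 < lam) (hxi : 0 ≤ xi) (hfix : quadP lam xi = xi)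
    (hF : IsPoincareFunction lam xi F) (hr : IsPoincareRadius F r) (hv : ‖v‖ < r)
    (him : 0 < v.im) :
    -(Real.pi / 2) < (localLift xi F v).re ∧ (localLift xi F v).re < 0 := by
  obtain ⟨h1, h2⟩ := localLift_arg hlam hxi hfix hF hr hv him
  obtain ⟨h3, h4⟩ := stripArccos_re h1
  refine ⟨?_, h4⟩
  rw [← cos_stripArccos h1, Complex.cos_re] at h2
  by_contra hcon
  push Not at hcon
  have h5 := Real.cos_nonpos_of_pi_div_two_le_of_le (x := -(stripArccos (1 + F v / xi)).re)
    (by rw [localLift] at hcon; linarith) (by linarith [Real.pi_pos])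
  rw [Real.cos_neg] at h5
  nlinarith [Real.cosh_pos (stripArccos (1 + F v / xi)).im]

theorem mem_scaledComb_of_re {s : ℂ} (h1 : -Real.pi < s.re) (h2 : s.re < 0) (him : 0 < s.im) :
    s ∈ scaledComb lam xi := by
  refine ⟨h2, him, fun l hl hre => ?_⟩
  exfalso
  have : (1 : ℝ) ≤ l := by exact_mod_cast hl
  nlinarith [Real.pi_pos]

theorem localLift_mem (hlam : 2 < lam) (hxi : 0 ≤ xi) (hfix : quadP lam xi = xi)
    (hF : IsPoincareFunction lam xi F) (hr : IsPoincareRadius F r) (hv : ‖v‖ < r)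
    (him : 0 < v.im) : localLift xi F v ∈ scaledComb lam xi := by
  obtain ⟨h1, h2⟩ := localLift_re hlam hxi hfix hF hr hv him
  exact mem_scaledComb_of_re (by linarith [Real.pi_pos]) h2
    (localLift_im_pos hlam hxi hfix hF hr hv him)

theorem IsPoincareFunction.add_fixedPoint (hF : IsPoincareFunction lam xi F) (v : ℂ) (n : ℕ) :
    F ((2 * xi : ℂ) ^ n * v) + xi = (quadP (lam : ℂ))^[n] (F v + xi) := by
  induction n with
  | zero => simp
  | succ n ih =>
    rw [Function.iterate_succ_apply', ← ih, pow_succ', mul_assoc, ← hF.equation, quadPHat,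
      sub_add_cancel]

theorem norm_two_mul_pow (hxi : 0 ≤ xi) (n : ℕ) (v : ℂ) :
    ‖(2 * xi : ℂ) ^ n * v‖ = (2 * xi) ^ n * ‖v‖ := by
  rw [norm_mul, norm_pow, norm_mul, Complex.norm_ofNat, Complex.norm_real, Real.norm_eq_abs,
    abs_of_nonneg hxi]

theorem im_two_mul_pow_mul (n : ℕ) (v : ℂ) :
    ((2 * xi : ℂ) ^ n * v).im = (2 * xi) ^ n * v.im := by
  have : (2 * xi : ℂ) ^ n = (((2 * xi) ^ n : ℝ) : ℂ) := by push_cast; rfl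
  rw [this, Complex.im_ofReal_mul]

/-- The local lift conjugates multiplication by `2 ξ` to `L`: both sides have the same cosine and
lie in the half-strip `-π ≤ Re t < 0`. -/
theorem localLift_mul (hlam : 2 < lam) (hxi : 0 ≤ xi) (hfix : quadP lam xi = xi)
    (hF : IsPoincareFunction lam xi F) (hr : IsPoincareRadius F r) (him : 0 < v.im) (k : ℕ)
    (hv : ‖(2 * xi : ℂ) ^ k * v‖ < r) :
    localLift xi F ((2 * xi : ℂ) ^ k * v) = (combStep xi)^[k] (localLift xi F v) := by
  have h2 := two_lt_fixedPoint hlam hxi hfix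
  induction k with
  | zero => simp
  | succ k ih =>
    set u := (2 * xi : ℂ) ^ k * v with hu
    have e : (2 * xi : ℂ) ^ (k + 1) * v = (2 * xi : ℂ) ^ 1 * u := by rw [hu]; ring
    rw [e] at hv ⊢
    have hu' : ‖u‖ < r := by
      rw [norm_two_mul_pow hxi, pow_one] at hv
      nlinarith [norm_nonneg u]
    have him' : 0 < u.im := by
      rw [hu, im_two_mul_pow_mul]
      have : 0 < xi := by linarith
      positivity
    have him1 : 0 < ((2 * xi : ℂ) ^ 1 * u).im := by
      rw [im_two_mul_pow_mul]
      have : 0 < xi := by linarith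
      positivity
    rw [Function.iterate_succ_apply', ← ih hu']
    have hUim := localLift_im_pos hlam hxi hfix hF hr hu' him'
    obtain ⟨hU1, hU2⟩ := localLift_re hlam hxi hfix hF hr hu' him'
    obtain ⟨hV1, hV2⟩ := localLift_re hlam hxi hfix hF hr hv him1
    refine Complex.eq_of_cos_eq_cos (localLift_im_pos hlam hxi hfix hF hr hv him1)
      (combStep_im_pos hlam hxi hfix hUim) ?_ ?_
    · have hx : (xi : ℂ) ≠ 0 := by exact_mod_cast (by linarith : xi ≠ 0)
      apply mul_left_cancel₀ hx
      rw [cos_localLift hlam hxi hfix hF hr hv him1, cos_combStep hlam hxi hfix hUim,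
        cos_localLift hlam hxi hfix hF hr hu' him', hF.add_fixedPoint]
      rfl
    · have h5 := (combStep_re_neg_iff hlam hxi hfix hUim).2 hU2
      have h6 := (combStep_re_lt_iff hlam hxi hfix hUim (-1)).1
      push_cast at h6
      have h7 : -Real.pi ≤ (combStep xi (localLift xi F u)).re := by
        by_contra hcon
        push Not at hcon
        have := h6.1 (by linarith)
        linarith
      rw [abs_lt]
      have := Real.pi_pos
      constructor <;> linarith

/-- `X` extends the local lift to the upper half-plane by means of the self-map `L` of the comb.
The standing assumptions on `λ`, `ξ`, `F` and `r` are part of the structure. -/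
structure IsCombLift (lam xi : ℝ) (F : ℂ → ℂ) (r : ℝ) (X : ℂ → ℂ) : Prop where
  two_lt : 2 < lam
  nonneg : 0 ≤ xi
  fixed : quadP lam xi = xi
  poincare : IsPoincareFunction lam xi F
  radius : IsPoincareRadius F r
  apply_mul : ∀ (n : ℕ) (v : ℂ), 0 < v.im → ‖v‖ < r →
    X ((2 * xi : ℂ) ^ n * v) = (combStep xi)^[n] (localLift xi F v)

theorem exists_eq_pow_mul (h2 : 2 < xi) {ε : ℝ} (hε : 0 < ε) (R : ℝ) :
    ∃ n : ℕ, ∀ w : ℂ, ‖w‖ ≤ R → 0 < w.im → ∃ v : ℂ, 0 < v.im ∧ ‖v‖ < ε ∧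
      (2 * xi : ℂ) ^ n * v = w := by
  obtain ⟨n, hn⟩ := pow_unbounded_of_one_lt (R / ε) (by linarith : 1 < 2 * xi)
  have hpos : 0 < (2 * xi) ^ n := by positivity
  have hne : (2 * xi : ℂ) ^ n ≠ 0 := by
    exact_mod_cast hpos.ne'
  refine ⟨n, fun w hw him => ?_⟩
  have hmul : (2 * xi : ℂ) ^ n * (w / (2 * xi : ℂ) ^ n) = w := mul_div_cancel₀ _ hne
  refine ⟨w / (2 * xi : ℂ) ^ n, ?_, ?_, hmul⟩
  · have := congrArg Complex.im hmul
    rw [im_two_mul_pow_mul] at this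
    rw [← this] at him
    exact pos_of_mul_pos_right him hpos.le
  · have := congrArg norm hmul
    rw [norm_two_mul_pow (by linarith)] at this
    rw [div_lt_iff₀ hε] at hn
    by_contra hcon
    push Not at hcon
    nlinarith

/-- The values prescribed for the lift at `w` by the representations `w = (2 ξ) ^ n v` with
`|v| < r` agree. -/
theorem exists_isCombLift (hlam : 2 < lam) (hxi : 0 ≤ xi) (hfix : quadP lam xi = xi)
    (hF : IsPoincareFunction lam xi F) (hr : IsPoincareRadius F r) : 
    ∃ X, IsCombLift lam xi F r X := by
  have h2 := two_lt_fixedPoint hlam hxi hfix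
  have hex : ∀ w : ℂ, ∃ y : ℂ, ∀ (n : ℕ) (v : ℂ), 0 < v.im → ‖v‖ < r →
      (2 * xi : ℂ) ^ n * v = w → y = (combStep xi)^[n] (localLift xi F v) := by
    intro w
    by_cases hw : ∃ (n : ℕ) (v : ℂ), 0 < v.im ∧ ‖v‖ < r ∧ (2 * xi : ℂ) ^ n * v = w
    · obtain ⟨m, u, hu, hur, huw⟩ := hw
      have key : ∀ (m k : ℕ) (u v : ℂ), 0 < u.im → 0 < v.im → ‖u‖ < r → ‖v‖ < r →
          (2 * xi : ℂ) ^ m * u = (2 * xi : ℂ) ^ (m + k) * v →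
          (combStep xi)^[m] (localLift xi F u) = (combStep xi)^[m + k] (localLift xi F v) := by
        intro m k u v hu hv hur hvr h
        have hne : (2 * xi : ℂ) ^ m ≠ 0 := pow_ne_zero _ (by
          exact_mod_cast (by linarith : 2 * xi ≠ 0))
        have huv : u = (2 * xi : ℂ) ^ k * v := by
          apply mul_left_cancel₀ hne
          rw [h, pow_add]
          ring
        rw [Function.iterate_add_apply, huv,
          localLift_mul hlam hxi hfix hF hr hv k (by rw [← huv]; exact hur)]
      refine ⟨(combStep xi)^[m] (localLift xi F u), fun n v hv hvr hvw => ?_⟩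
      rcases le_total m n with h | h
      · obtain ⟨k, rfl⟩ := Nat.exists_eq_add_of_le h
        exact key m k u v hu hv hur hvr (by rw [huw, hvw])
      · obtain ⟨k, rfl⟩ := Nat.exists_eq_add_of_le h
        exact (key n k v u hv hu hvr hur (by rw [huw, hvw])).symm
    · exact ⟨0, fun n v h1 h3 h4 => absurd ⟨n, v, h1, h3, h4⟩ hw⟩
  choose X hX using hex
  exact ⟨X, hlam, hxi, hfix, hF, hr, fun n v h1 h3 => hX _ n v h1 h3 rfl⟩

namespace IsCombLift

theorem two_lt_xi (hX : IsCombLift lam xi F r X) : 2 < xi :=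
  two_lt_fixedPoint hX.two_lt hX.nonneg hX.fixed

theorem localLift_im_pos (hX : IsCombLift lam xi F r X) (hv : ‖v‖ < r) (him : 0 < v.im) :
    0 < (localLift xi F v).im :=
  _root_.localLift_im_pos hX.two_lt hX.nonneg hX.fixed hX.poincare hX.radius hv him

theorem mem_scaledComb (hX : IsCombLift lam xi F r X) (hw : 0 < w.im) :
    X w ∈ scaledComb lam xi := by
  obtain ⟨n, hn⟩ := exists_eq_pow_mul hX.two_lt_xi hX.radius.pos ‖w‖
  obtain ⟨v, hv, hvr, rfl⟩ := hn w le_rfl hw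
  rw [hX.apply_mul n v hv hvr, combStep_iterate_mem_scaledComb_iff hX.two_lt hX.nonneg hX.fixed
    (hX.localLift_im_pos hvr hv)]
  exact localLift_mem hX.two_lt hX.nonneg hX.fixed hX.poincare hX.radius hvr hv

theorem eq_localLift (hX : IsCombLift lam xi F r X) (hv : 0 < v.im) (hvr : ‖v‖ < r) :
    X v = localLift xi F v := by
  simpa using hX.apply_mul 0 v hv hvr

theorem cos_eq (hX : IsCombLift lam xi F r X) (hw : 0 < w.im) :
    (xi : ℂ) * Complex.cos (X w) = F w + xi := by
  obtain ⟨n, hn⟩ := exists_eq_pow_mul hX.two_lt_xi hX.radius.pos ‖w‖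
  obtain ⟨v, hv, hvr, rfl⟩ := hn w le_rfl hw
  rw [hX.apply_mul n v hv hvr, cos_combStep_iterate hX.two_lt hX.nonneg hX.fixed
    (hX.localLift_im_pos hvr hv), hX.poincare.add_fixedPoint,
    cos_localLift hX.two_lt hX.nonneg hX.fixed hX.poincare hX.radius hvr hv]

theorem localLift_injOn (hX : IsCombLift lam xi F r X) (hv : ‖v‖ < r) (hw : ‖w‖ < r)
    (hvim : 0 < v.im) (hwim : 0 < w.im) (h : localLift xi F v = localLift xi F w) : v = w := by
  have h1 := cos_localLift hX.two_lt hX.nonneg hX.fixed hX.poincare hX.radius hv hvim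
  have h3 := cos_localLift hX.two_lt hX.nonneg hX.fixed hX.poincare hX.radius hw hwim
  rw [h, h3] at h1
  exact hX.radius.injOn hv hw (add_right_cancel h1.symm)

theorem injOn (hX : IsCombLift lam xi F r X) : Set.InjOn X upperHalf := by
  intro a ha b hb hab
  obtain ⟨n, hn⟩ := exists_eq_pow_mul hX.two_lt_xi hX.radius.pos (max ‖a‖ ‖b‖)
  obtain ⟨v, hv, hvr, rfl⟩ := hn a (le_max_left _ _) ha
  obtain ⟨w, hw, hwr, rfl⟩ := hn b (le_max_right _ _) hb
  rw [hX.apply_mul n v hv hvr, hX.apply_mul n w hw hwr] at hab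
  have := combStep_iterate_injOn hX.two_lt hX.nonneg hX.fixed n (hX.localLift_im_pos hvr hv)
    (hX.localLift_im_pos hwr hw) hab
  rw [hX.localLift_injOn hvr hwr hv hw this]

theorem differentiableAt_localLift (hX : IsCombLift lam xi F r X) (hv : ‖v‖ < r)
    (him : 0 < v.im) : DifferentiableAt ℂ (localLift xi F) v := by
  have h := localLift_arg hX.two_lt hX.nonneg hX.fixed hX.poincare hX.radius hv him
  have h1 : DifferentiableAt ℂ (fun v => 1 + F v / xi) v :=
    (((hX.poincare.entire v).div_const _).const_add _)
  exact (differentiableAt_stripArccos h.1).comp v h1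

theorem differentiableAt (hX : IsCombLift lam xi F r X) (hw : 0 < w.im) :
    DifferentiableAt ℂ X w := by
  have h2 := hX.two_lt_xi
  obtain ⟨n, hn⟩ := exists_eq_pow_mul hX.two_lt_xi hX.radius.pos ‖w‖
  obtain ⟨v, hv, hvr, hvw⟩ := hn w le_rfl hw
  have hne : (2 * xi : ℂ) ^ n ≠ 0 := pow_ne_zero _ (by
    exact_mod_cast (by linarith : 2 * xi ≠ 0))
  have hv' : w / (2 * xi : ℂ) ^ n = v := by
    rw [← hvw]
    field_simp
  have hd : DifferentiableAt ℂ (fun z => (combStep xi)^[n] (localLift xi F (z / (2 * xi : ℂ) ^ n)))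
      w := by
    have h1 : DifferentiableAt ℂ (fun z : ℂ => z / (2 * xi : ℂ) ^ n) w :=
      differentiableAt_id.div_const _
    have h3 : DifferentiableAt ℂ (fun z => localLift xi F (z / (2 * xi : ℂ) ^ n)) w := by
      refine DifferentiableAt.comp (g := localLift xi F) w ?_ h1
      rw [hv']
      exact hX.differentiableAt_localLift hvr hv
    refine DifferentiableAt.comp (g := (combStep xi)^[n]) w ?_ h3
    rw [hv']
    exact differentiableAt_combStep_iterate hX.two_lt hX.nonneg hX.fixed
      (hX.localLift_im_pos hvr hv) n
  refine hd.congr_of_eventuallyEq ?_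
  have hc : ContinuousAt (fun z : ℂ => z / (2 * xi : ℂ) ^ n) w :=
    (continuous_id.div_const _).continuousAt
  have e1 : ∀ᶠ z in 𝓝 w, ‖z / (2 * xi : ℂ) ^ n‖ < r :=
    hc.norm.eventually_lt continuousAt_const (by rw [hv']; exact hvr)
  have e2 : ∀ᶠ z in 𝓝 w, 0 < (z / (2 * xi : ℂ) ^ n).im :=
    continuousAt_const.eventually_lt (Complex.continuous_im.continuousAt.comp hc) (by
      simp only [hv']; exact hv)
  filter_upwards [e1, e2] with z h3 h4
  rw [← hX.apply_mul n _ h4 h3, mul_div_cancel₀ _ hne]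

/-- Near the corner `0` of the comb the lift is inverted by means of a local inverse of `F`. -/
theorem exists_localLift_eq (hX : IsCombLift lam xi F r X) {ε : ℝ} (hε : 0 < ε) :
    ∃ δ > 0, ∀ s : ℂ, 0 < s.im → -(Real.pi / 2) ≤ s.re → s.re < 0 →
      ‖(xi : ℂ) * Complex.cos s - xi‖ < δ →
      ∃ v : ℂ, 0 < v.im ∧ ‖v‖ < ε ∧ ‖v‖ < r ∧ localLift xi F v = s := by
  have h2 := hX.two_lt_xi
  obtain ⟨δ, hδ, h⟩ := hX.poincare.exists_preimage (lt_min hε hX.radius.pos)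
  refine ⟨δ, hδ, fun s him h1 h3 hs => ?_⟩
  obtain ⟨v, hv, hFv⟩ := h _ hs
  have hvr := hv.trans_le (min_le_right _ _)
  have hvim : 0 < v.im := by
    rw [← hX.radius.im_pos_iff hX.two_lt hX.nonneg hX.fixed hX.poincare hvr, hFv]
    simp only [Complex.sub_im, Complex.im_ofReal_mul, Complex.cos_im, Complex.ofReal_im, sub_zero]
    have h4 := Real.sin_neg_of_neg_of_neg_pi_lt h3 (by linarith [Real.pi_pos])
    have h5 := Real.sinh_pos_iff.2 him
    have h6 : 0 < xi := by linarith
    have := mul_pos (mul_pos h6 (neg_pos.2 h4)) h5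
    linarith
  refine ⟨v, hvim, hv.trans_le (min_le_left _ _), hvr, ?_⟩
  obtain ⟨h7, h8⟩ := localLift_re hX.two_lt hX.nonneg hX.fixed hX.poincare hX.radius hvr hvim
  refine Complex.eq_of_cos_eq_cos (hX.localLift_im_pos hvr hvim) him ?_ ?_
  · have hx : (xi : ℂ) ≠ 0 := by exact_mod_cast (by linarith : xi ≠ 0)
    apply mul_left_cancel₀ hx
    rw [cos_localLift hX.two_lt hX.nonneg hX.fixed hX.poincare hX.radius hvr hvim, hFv]
    ring
  · rw [abs_lt]
    constructor <;> linarith [Real.pi_pos]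

/-- The lift is onto the comb, and preimages of bounded sets are bounded. -/
theorem exists_eq (hX : IsCombLift lam xi F r X) (R : ℝ) :
    ∃ R' : ℝ, ∀ t ∈ scaledComb lam xi, ‖t‖ ≤ R → ∃ w ∈ upperHalf, ‖w‖ ≤ R' ∧ X w = t := by
  have h2 := hX.two_lt_xi
  obtain ⟨δ, hδ, h⟩ := hX.exists_localLift_eq one_pos
  obtain ⟨n, hn⟩ := exists_backward_orbit hX.two_lt hX.nonneg hX.fixed R hδ
  refine ⟨(2 * xi) ^ n, fun t ht htR => ?_⟩
  obtain ⟨s, hs, hst, hre, hlt⟩ := hn t ht htR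
  obtain ⟨v, hv, hv1, hvr, hvs⟩ := h s hs.2.1 hre hs.1 hlt
  have hpos : 0 < (2 * xi) ^ n := by positivity
  refine ⟨(2 * xi : ℂ) ^ n * v, ?_, ?_, ?_⟩
  · change 0 < ((2 * xi : ℂ) ^ n * v).im
    rw [im_two_mul_pow_mul]
    positivity
  · rw [norm_two_mul_pow hX.nonneg]
    nlinarith
  · rw [hX.apply_mul n v hv hvr, hvs, hst]

/-- If `X w` is near the corner `0` of the comb, then `w` is near `0`. -/
theorem exists_norm_lt_of_norm_lt (hX : IsCombLift lam xi F r X) {ε : ℝ} (hε : 0 < ε) :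
    ∃ δ > 0, ∀ w ∈ upperHalf, ‖X w‖ < δ → ‖w‖ < ε := by
  obtain ⟨δ, hδ, h⟩ := hX.exists_localLift_eq hε
  have hc : ContinuousAt (fun s : ℂ => ‖(xi : ℂ) * Complex.cos s - xi‖) 0 := by fun_prop
  have hlt : ∀ᶠ s in 𝓝 (0 : ℂ), ‖(xi : ℂ) * Complex.cos s - xi‖ < δ :=
    hc.eventually_lt continuousAt_const (by simpa using hδ)
  obtain ⟨η, hη, hlt⟩ := Metric.eventually_nhds_iff.1 hlt
  refine ⟨min η (Real.pi / 2), lt_min hη (by positivity), fun w hw hwX => ?_⟩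
  have hm := hX.mem_scaledComb hw
  have hre := abs_lt.1 ((Complex.abs_re_le_norm (X w)).trans_lt
    (hwX.trans_le (min_le_right _ _)))
  obtain ⟨v, hv, hvε, hvr, hvX⟩ := h (X w) hm.2.1 hre.1.le hm.1
    (hlt (by simpa using hwX.trans_le (min_le_left _ _)))
  rw [← hX.eq_localLift hv hvr] at hvX
  rwa [← hX.injOn hv hw hvX]

theorem tendsto_zero (hX : IsCombLift lam xi F r X) : Tendsto X (𝓝[upperHalf] 0) (𝓝 0) := by
  have h1 : Tendsto (fun v => 1 + F v / xi) (𝓝[upperHalf] 0) (𝓝[{c | 0 < c.im}] 1) := by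
    refine tendsto_nhdsWithin_iff.2 ⟨?_, ?_⟩
    · have hc : Continuous (fun v => 1 + F v / xi) :=
        continuous_const.add (hX.poincare.entire.continuous.div_const _)
      have := hc.tendsto 0
      rw [hX.poincare.map_zero, zero_div, add_zero] at this
      exact this.mono_left nhdsWithin_le_nhds
    · filter_upwards [self_mem_nhdsWithin,
        nhdsWithin_le_nhds (Metric.ball_mem_nhds 0 hX.radius.pos)]
        with v hv hvr
      exact (localLift_arg hX.two_lt hX.nonneg hX.fixed hX.poincare hX.radius
        (by simpa using hvr) hv).1
  refine (tendsto_stripArccos.comp h1).congr' ?_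
  filter_upwards [self_mem_nhdsWithin, nhdsWithin_le_nhds (Metric.ball_mem_nhds 0 hX.radius.pos)]
    with v hv hvr
  exact (hX.eq_localLift hv (by simpa using hvr)).symm

/-- The lift is bounded on bounded subsets of the upper half-plane. -/
theorem exists_norm_le (hX : IsCombLift lam xi F r X) (R : ℝ) :
    ∃ R' : ℝ, ∀ w ∈ upperHalf, ‖w‖ ≤ R → ‖X w‖ ≤ R' := by
  have h1 : ∀ᶠ v in 𝓝[upperHalf] (0 : ℂ), ‖X v‖ < 1 :=
    hX.tendsto_zero.norm.eventually_lt_const (by simp)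
  obtain ⟨ε, hε, h1⟩ := Metric.mem_nhdsWithin_iff.1 h1
  obtain ⟨n, hn⟩ := exists_eq_pow_mul hX.two_lt_xi (lt_min hε hX.radius.pos) R
  obtain ⟨R', hR'⟩ := exists_norm_combStep_iterate_le hX.two_lt hX.nonneg hX.fixed 1 n
  refine ⟨R', fun w hw hwR => ?_⟩
  obtain ⟨v, hv, hvε, rfl⟩ := hn w hwR hw
  have hvr := hvε.trans_le (min_le_right _ _)
  have hle : ‖X v‖ < 1 := h1 ⟨by simpa using hvε.trans_le (min_le_left _ _), hv⟩
  rw [hX.eq_localLift hv hvr] at hle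
  rw [hX.apply_mul n v hv hvr]
  exact hR' _ (hX.localLift_im_pos hvr hv) hle.le

theorem apply_pow_mul (hX : IsCombLift lam xi F r X) (hw : 0 < w.im) (n : ℕ) :
    X ((2 * xi : ℂ) ^ n * w) = (combStep xi)^[n] (X w) := by
  obtain ⟨m, hm⟩ := exists_eq_pow_mul hX.two_lt_xi hX.radius.pos ‖w‖
  obtain ⟨v, hv, hvr, rfl⟩ := hm w le_rfl hw
  rw [← mul_assoc, ← pow_add, hX.apply_mul _ v hv hvr, hX.apply_mul _ v hv hvr,
    Function.iterate_add_apply]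

end IsCombLift

end lift

/-! ### Inverses of injective holomorphic maps -/

section inverse

variable {f : ℂ → ℂ} {U : Set ℂ} {a : ℂ}

/-- An injective holomorphic function is open. -/
theorem nhds_le_map_nhds_of_injOn (hU : IsOpen U) (hf : DifferentiableOn ℂ f U)
    (hinj : Set.InjOn f U) (ha : a ∈ U) : 𝓝 (f a) ≤ map f (𝓝 a) := by
  refine ((hf.analyticAt (hU.mem_nhds ha)).eventually_constant_or_nhds_le_map_nhds).resolve_left ?_
  intro h
  have h1 : ∀ᶠ z in 𝓝[≠] a, False := by
    filter_upwards [h.filter_mono nhdsWithin_le_nhds,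
      nhdsWithin_le_nhds (hU.mem_nhds ha), self_mem_nhdsWithin] with z h1 h2 h3
    exact h3 (hinj h2 ha h1)
  exact h1.exists.choose_spec

theorem continuousAt_invFunOn_of_injOn (hU : IsOpen U) (hf : DifferentiableOn ℂ f U)
    (hinj : Set.InjOn f U) (ha : a ∈ U) : ContinuousAt (Function.invFunOn f U) (f a) := by
  have hga : Function.invFunOn f U (f a) = a := hinj.leftInvOn_invFunOn ha
  intro V hV
  rw [hga] at hV
  have hm : f '' (V ∩ U) ∈ 𝓝 (f a) := nhds_le_map_nhds_of_injOn hU hf hinj ha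
    (image_mem_map (inter_mem hV (hU.mem_nhds ha)))
  rw [mem_map]
  refine mem_of_superset hm ?_
  rintro _ ⟨z, ⟨hzV, hzU⟩, rfl⟩
  rw [Set.mem_preimage, hinj.leftInvOn_invFunOn hzU]
  exact hzV

/-- The inverse of an injective holomorphic function is holomorphic: it is continuous, and it is
differentiable outside of the images of the isolated critical points, which are removable
singularities. -/
theorem differentiableAt_invFunOn_of_injOn (hU : IsOpen U) (hf : DifferentiableOn ℂ f U)
    (hinj : Set.InjOn f U) (ha : a ∈ U) : DifferentiableAt ℂ (Function.invFunOn f U) (f a) := by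
  have hreg : ∀ b ∈ U, deriv f b ≠ 0 → DifferentiableAt ℂ (Function.invFunOn f U) (f b) := by
    intro b hb hd
    have hgb : Function.invFunOn f U (f b) = b := hinj.leftInvOn_invFunOn hb
    refine (HasDerivAt.of_local_left_inverse (f := f) (f' := deriv f b)
      (continuousAt_invFunOn_of_injOn hU hf hinj hb) ?_ hd ?_).differentiableAt
    · rw [hgb]
      exact (hf.differentiableAt (hU.mem_nhds hb)).hasDerivAt
    · have hm : f '' U ∈ 𝓝 (f b) := nhds_le_map_nhds_of_injOn hU hf hinj hb
        (image_mem_map (hU.mem_nhds hb))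
      refine mem_of_superset hm ?_
      rintro _ ⟨z, hz, rfl⟩
      exact congrArg f (hinj.leftInvOn_invFunOn hz)
  have hga : Function.invFunOn f U (f a) = a := hinj.leftInvOn_invFunOn ha
  have hcont := continuousAt_invFunOn_of_injOn hU hf hinj ha
  refine (Complex.analyticAt_of_differentiable_on_punctured_nhds_of_continuousAt ?_
    hcont).differentiableAt
  have hder : ∀ᶠ z in 𝓝[≠] a, deriv f z ≠ 0 := by
    refine (hf.analyticAt
      (hU.mem_nhds ha)).deriv.eventually_eq_zero_or_eventually_ne_zero.resolve_left ?_
    intro h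
    obtain ⟨ε, hε, hball⟩ := Metric.mem_nhds_iff.1 (inter_mem h (hU.mem_nhds ha))
    have hconst : ∀ᶠ z in 𝓝[≠] a, False := by
      filter_upwards [self_mem_nhdsWithin,
        nhdsWithin_le_nhds (Metric.ball_mem_nhds a hε)] with z h1 h2
      refine h1 (hinj (hball h2).2 ha ?_)
      exact Metric.isOpen_ball.is_const_of_deriv_eq_zero
        (convex_ball a ε).isPreconnected (hf.mono fun y hy => (hball hy).2)
        (fun y hy => (hball hy).1) h2 (Metric.mem_ball_self hε)
    exact hconst.exists.choose_spec
  rw [eventually_nhdsWithin_iff] at hder ⊢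
  have h1 := hcont.eventually (p := fun z => z ∈ ({a}ᶜ : Set ℂ) → deriv f z ≠ 0)
    (by rw [hga]; exact hder)
  have h2 : f '' U ∈ 𝓝 (f a) := nhds_le_map_nhds_of_injOn hU hf hinj ha
    (image_mem_map (hU.mem_nhds ha))
  filter_upwards [h1, h2] with y hy hyU hne
  obtain ⟨b, hb, rfl⟩ := hyU
  rw [hinj.leftInvOn_invFunOn hb] at hy
  exact hreg b hb (hy fun h => hne (by rw [h]; rfl))

end inverse

/-! ### Automorphisms of the upper half-plane -/

theorem isOpen_upperHalf : IsOpen upperHalf :=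
  isOpen_lt continuous_const Complex.continuous_im

/-- The Cayley transform of the upper half-plane onto the unit disc. -/
noncomputable def cayley (w : ℂ) : ℂ := (w - Complex.I) / (w + Complex.I)

/-- The inverse Cayley transform. -/
noncomputable def cayleyInv (z : ℂ) : ℂ := Complex.I * (1 + z) / (1 - z)

theorem add_I_ne_zero {w : ℂ} (hw : w ∈ upperHalf) : w + Complex.I ≠ 0 := by
  intro h
  have h1 := congrArg Complex.im h
  have h2 : 0 < w.im := hw
  simp at h1
  linarith

theorem norm_cayley_lt {w : ℂ} (hw : w ∈ upperHalf) : ‖cayley w‖ < 1 := by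
  have h2 : 0 < w.im := hw
  rw [cayley, norm_div, div_lt_one (norm_pos_iff.2 (add_I_ne_zero hw)),
    ← sq_lt_sq₀ (norm_nonneg _) (norm_nonneg _),
    ← Complex.normSq_eq_norm_sq, ← Complex.normSq_eq_norm_sq, Complex.normSq_apply,
    Complex.normSq_apply]
  simp
  nlinarith

theorem one_sub_ne_zero_of_norm_lt {z : ℂ} (hz : ‖z‖ < 1) : 1 - z ≠ 0 := by
  intro h
  rw [← sub_eq_zero.1 h] at hz
  simp at hz

theorem cayleyInv_mem {z : ℂ} (hz : ‖z‖ < 1) : cayleyInv z ∈ upperHalf := by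
  have h0 := Complex.normSq_pos.2 (one_sub_ne_zero_of_norm_lt hz)
  have h1 : Complex.normSq z < 1 := by
    rw [Complex.normSq_eq_norm_sq]
    nlinarith [norm_nonneg z]
  rw [Complex.normSq_apply] at h1
  change 0 < (cayleyInv z).im
  rw [cayleyInv, Complex.div_im, ← sub_div]
  apply div_pos _ h0
  simp
  nlinarith

theorem cayleyInv_cayley {w : ℂ} (hw : w ∈ upperHalf) : cayleyInv (cayley w) = w := by
  have h1 := add_I_ne_zero hw
  have h2 := one_sub_ne_zero_of_norm_lt (norm_cayley_lt hw)
  rw [cayleyInv, div_eq_iff h2, cayley]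
  field_simp
  ring

theorem cayley_cayleyInv {z : ℂ} (hz : ‖z‖ < 1) : cayley (cayleyInv z) = z := by
  have h1 := add_I_ne_zero (cayleyInv_mem hz)
  have h2 := one_sub_ne_zero_of_norm_lt hz
  rw [cayley, div_eq_iff h1, cayleyInv]
  field_simp
  ring

theorem differentiableOn_cayley : DifferentiableOn ℂ cayley upperHalf := fun w hw =>
  (DifferentiableAt.div (c := fun w => w - Complex.I) (d := fun w => w + Complex.I)
    (by fun_prop) (by fun_prop) (add_I_ne_zero hw)).differentiableWithinAt

theorem differentiableOn_cayleyInv : DifferentiableOn ℂ cayleyInv (Metric.ball 0 1) := fun z hz =>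
  (DifferentiableAt.div (c := fun z => Complex.I * (1 + z)) (d := fun z => 1 - z)
    (by fun_prop) (by fun_prop) (one_sub_ne_zero_of_norm_lt (by simpa using hz))).differentiableWithinAt

theorem tendsto_cayley_cobounded : Tendsto cayley (Bornology.cobounded ℂ) (𝓝 1) := by
  have h1 : Tendsto (fun w : ℂ => 1 - 2 * Complex.I * (w + Complex.I)⁻¹) (Bornology.cobounded ℂ)
      (𝓝 (1 - 2 * Complex.I * 0)) := by
    refine tendsto_const_nhds.sub (Tendsto.const_mul _ ?_)
    exact tendsto_inv₀_cobounded.comp (tendsto_add_const_cobounded _)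
  rw [mul_zero, sub_zero] at h1
  refine h1.congr' ?_
  have : ∀ᶠ w : ℂ in Bornology.cobounded ℂ, w ≠ -Complex.I :=
    Bornology.eventually_ne_cobounded _
  filter_upwards [this] with w hw
  have hw' : w + Complex.I ≠ 0 := fun h => hw (eq_neg_of_add_eq_zero_left h)
  rw [cayley]
  field_simp
  ring

/-- The upper half-plane is unbounded. -/
theorem cobounded_inf_upperHalf_neBot : (Bornology.cobounded ℂ ⊓ 𝓟 upperHalf).NeBot := by
  have h : Tendsto (fun y : ℝ => (y : ℂ) * Complex.I) atTop
      (Bornology.cobounded ℂ ⊓ 𝓟 upperHalf) := by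
    refine tendsto_inf.2 ⟨?_, ?_⟩
    · rw [← tendsto_norm_atTop_iff_cobounded]
      simpa using tendsto_abs_atTop_atTop
    · rw [tendsto_principal]
      filter_upwards [eventually_gt_atTop 0] with y hy
      simpa [upperHalf] using hy
  exact h.neBot

/-- An automorphism of the upper half-plane that fixes `i` and tends to `∞` at `∞` is the identity:
conjugated to the disc it is a rotation by the Schwarz lemma. -/
theorem eqOn_id_of_bijOn_upperHalf {φ : ℂ → ℂ} (hd : DifferentiableOn ℂ φ upperHalf)
    (hb : Set.BijOn φ upperHalf upperHalf) (hI : φ Complex.I = Complex.I)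
    (hinf : Tendsto φ (Bornology.cobounded ℂ ⊓ 𝓟 upperHalf) (Bornology.cobounded ℂ)) :
    Set.EqOn φ id upperHalf := by
  have hImem : Complex.I ∈ upperHalf := by simp [upperHalf]
  have hball : ∀ {z : ℂ}, z ∈ Metric.ball (0 : ℂ) 1 ↔ ‖z‖ < 1 := by simp
  have h0 : cayleyInv 0 = Complex.I := by simp [cayleyInv]
  have hc : cayley Complex.I = 0 := by simp [cayley]
  set ψ := Function.invFunOn φ upperHalf
  have hψd : DifferentiableOn ℂ ψ upperHalf := fun w hw => by
    obtain ⟨v, hv, rfl⟩ := hb.surjOn hw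
    exact (differentiableAt_invFunOn_of_injOn isOpen_upperHalf hd hb.injOn
      hv).differentiableWithinAt
  have hψm : Set.MapsTo ψ upperHalf upperHalf := hb.surjOn.mapsTo_invFunOn
  -- conjugation by the Cayley transform turns self-maps fixing `i` into contractions
  have hconj : ∀ {χ : ℂ → ℂ}, DifferentiableOn ℂ χ upperHalf → Set.MapsTo χ upperHalf upperHalf →
      DifferentiableOn ℂ (fun z => cayley (χ (cayleyInv z))) (Metric.ball 0 1) ∧
      Set.MapsTo (fun z => cayley (χ (cayleyInv z))) (Metric.ball 0 1) (Metric.closedBall 0 1) := by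
    intro χ hχ hm
    have hm1 : Set.MapsTo cayleyInv (Metric.ball 0 1) upperHalf :=
      fun z hz => cayleyInv_mem (hball.1 hz)
    refine ⟨differentiableOn_cayley.comp (hχ.comp differentiableOn_cayleyInv hm1)
      (hm.comp hm1), fun z hz => ?_⟩
    simpa using (norm_cayley_lt (hm (hm1 hz))).le
  obtain ⟨hf1, hf2⟩ := hconj hd hb.mapsTo
  obtain ⟨hg1, hg2⟩ := hconj hψd hψm
  have hψφ : ∀ w ∈ upperHalf, ψ (φ w) = w := fun w hw => hb.injOn.leftInvOn_invFunOn hw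
  have hψI : ψ Complex.I = Complex.I := by
    have := hψφ _ hImem
    rwa [hI] at this
  set f : ℂ → ℂ := fun z => cayley (φ (cayleyInv z)) with hf
  set g : ℂ → ℂ := fun z => cayley (ψ (cayleyInv z)) with hg
  have hf0 : f 0 = 0 := by simp only [hf, h0, hI, hc]
  have hg0 : g 0 = 0 := by simp only [hg, h0, hψI, hc]
  have hz0 : ‖(1 / 2 : ℂ)‖ < 1 := by norm_num
  have hfz : ‖f (1 / 2)‖ < 1 := norm_cayley_lt (hb.mapsTo (cayleyInv_mem hz0))
  have hgf : g (f (1 / 2)) = 1 / 2 := by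
    simp only [hf, hg]
    rw [cayleyInv_cayley (hb.mapsTo (cayleyInv_mem hz0)),
      hψφ _ (cayleyInv_mem hz0), cayley_cayleyInv hz0]
  have hn : ‖f (1 / 2)‖ = ‖(1 / 2 : ℂ)‖ := by
    apply le_antisymm (Complex.norm_le_norm_of_mapsTo_ball hf1 hf2 hf0 hz0)
    have := Complex.norm_le_norm_of_mapsTo_ball hg1 hg2 hg0 hfz
    rwa [hgf] at this
  have hrot := Complex.affine_of_mapsTo_ball_of_norm_dslope_eq_div (R₂ := 1) (z₀ := 1 / 2) hf1
    (by rw [hf0]; exact hf2) (hball.2 hz0) (by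
      rw [dslope_of_ne _ (by norm_num : (1 / 2 : ℂ) ≠ 0), slope_def_field, norm_div, hf0, sub_zero,
        sub_zero, hn]
      norm_num)
  set c := dslope f 0 (1 / 2)
  have hrot' : ∀ w ∈ upperHalf, cayley (φ w) = cayley w * c := by
    intro w hw
    have := hrot (hball.2 (norm_cayley_lt hw))
    simpa [hf, cayleyInv_cayley hw, h0, hI, hc] using this
  have hc1 : c = 1 := by
    have := cobounded_inf_upperHalf_neBot
    have hl : Tendsto (fun w => cayley (φ w)) (Bornology.cobounded ℂ ⊓ 𝓟 upperHalf) (𝓝 1) :=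
      tendsto_cayley_cobounded.comp hinf
    have hr : Tendsto (fun w => cayley w * c) (Bornology.cobounded ℂ ⊓ 𝓟 upperHalf)
        (𝓝 (1 * c)) :=
      (tendsto_cayley_cobounded.mono_left inf_le_left).mul_const c
    rw [one_mul] at hr
    refine (tendsto_nhds_unique (hl.congr' ?_) hr).symm
    filter_upwards [mem_inf_of_right (mem_principal_self _)] with w hw using hrot' w hw
  intro w hw
  have := hrot' w hw
  rw [hc1, mul_one] at this
  have h3 := congrArg cayleyInv this
  rwa [cayleyInv_cayley (hb.mapsTo hw), cayleyInv_cayley hw] at h3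

/-- The automorphisms of the upper half-plane that tend to `∞` at `∞` are the affine ones. -/
theorem exists_affine_of_bijOn_upperHalf {φ : ℂ → ℂ} (hd : DifferentiableOn ℂ φ upperHalf)
    (hb : Set.BijOn φ upperHalf upperHalf)
    (hinf : Tendsto φ (Bornology.cobounded ℂ ⊓ 𝓟 upperHalf) (Bornology.cobounded ℂ)) :
    ∃ a b : ℝ, 0 < a ∧ ∀ w ∈ upperHalf, φ w = a * w + b := by
  have hImem : Complex.I ∈ upperHalf := by simp [upperHalf]
  have hp : 0 < (φ Complex.I).im := hb.mapsTo hImem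
  set p := φ Complex.I with hpdef
  have hpc : (p.im : ℂ) ≠ 0 := by exact_mod_cast hp.ne'
  have hpI : p = p.re + p.im * Complex.I := (Complex.re_add_im p).symm
  have him : ∀ z : ℂ, ((z - p.re) / p.im).im = z.im / p.im := by
    intro z
    rw [Complex.div_ofReal_im]
    simp
  have hA : Set.BijOn (fun z : ℂ => (z - p.re) / p.im) upperHalf upperHalf := by
    refine ⟨fun z hz => ?_, fun z _ w _ h => ?_, fun z hz => ?_⟩
    · change 0 < ((z - p.re) / p.im).im
      rw [him]
      exact div_pos hz hp
    · simpa [div_left_inj' hpc] using h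
    · refine ⟨p.im * z + p.re, ?_, by field_simp; ring⟩
      change 0 < ((p.im : ℂ) * z + p.re).im
      simp only [Complex.add_im, Complex.im_ofReal_mul, Complex.ofReal_im, add_zero]
      exact mul_pos hp hz
  have h := eqOn_id_of_bijOn_upperHalf (φ := fun w => (φ w - p.re) / p.im)
    ((hd.sub_const _).div_const _) (hA.comp hb) (by
      change (p - p.re) / p.im = Complex.I
      rw [div_eq_iff hpc]
      linear_combination hpI) (by
      have h1 : Tendsto (fun z : ℂ => (z + -(p.re : ℂ)) * (p.im : ℂ)⁻¹) (Bornology.cobounded ℂ)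
          (Bornology.cobounded ℂ) :=
        (tendsto_mul_right_cobounded (inv_ne_zero hpc)).comp (tendsto_add_const_cobounded _)
      simpa [Function.comp_def, div_eq_mul_inv, sub_eq_add_neg] using h1.comp hinf)
  refine ⟨p.im, p.re, hp, fun w hw => ?_⟩
  have := h hw
  simp only [id] at this
  rw [div_eq_iff hpc] at this
  linear_combination this

/-! ### The normalized comb map -/

namespace IsCombLift

variable {lam xi r : ℝ} {F X Ψ : ℂ → ℂ}

theorem bijOn (hX : IsCombLift lam xi F r X) : Set.BijOn X upperHalf (scaledComb lam xi) := by
  refine ⟨fun w hw => hX.mem_scaledComb hw, hX.injOn, fun t ht => ?_⟩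
  obtain ⟨R', h⟩ := hX.exists_eq ‖t‖
  obtain ⟨w, hw, -, rfl⟩ := h t ht le_rfl
  exact ⟨w, hw, rfl⟩

theorem tendsto_cobounded (hX : IsCombLift lam xi F r X) :
    Tendsto X (Bornology.cobounded ℂ ⊓ 𝓟 upperHalf) (Bornology.cobounded ℂ) := by
  rw [← tendsto_norm_atTop_iff_cobounded, tendsto_atTop]
  intro R
  obtain ⟨R', h⟩ := hX.exists_eq R
  have h1 : ∀ᶠ w : ℂ in Bornology.cobounded ℂ, R' < ‖w‖ :=
    tendsto_norm_cobounded_atTop.eventually_gt_atTop R'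
  filter_upwards [mem_inf_of_left h1, mem_inf_of_right (mem_principal_self _)] with w hw hwH
  by_contra hcon
  push Not at hcon
  obtain ⟨w', hw', hle, heq⟩ := h (X w) (hX.mem_scaledComb hwH) hcon.le
  rw [hX.injOn hw' hwH heq] at hle
  have : R' < ‖w‖ := hw
  linarith

theorem scaledComb_bijOn (hlam : 2 < lam) (hxi : 0 ≤ xi) (hfix : quadP lam xi = xi) :
    Set.BijOn (fun z => (Real.pi : ℂ) * z) (combDomain lam xi) (scaledComb lam xi) := by
  have hpi : (Real.pi : ℂ) ≠ 0 := by exact_mod_cast Real.pi_ne_zero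
  refine ⟨fun z hz => (mem_combDomain_iff hlam hxi hfix).1 hz,
    fun z _ w _ h => mul_left_cancel₀ hpi h, fun t ht => ⟨t / Real.pi, ?_, ?_⟩⟩
  · rw [mem_combDomain_iff hlam hxi hfix, mul_div_cancel₀ _ hpi]
    exact ht
  · exact mul_div_cancel₀ _ hpi

/-- The comb map is `X / π`; its value at the boundary point `0` is set to `0`. -/
theorem isNormalizedCombMap (hX : IsCombLift lam xi F r X) :
    IsNormalizedCombMap lam xi (upperHalf.indicator fun w => X w / Real.pi) := by
  have hpi : (Real.pi : ℂ) ≠ 0 := by exact_mod_cast Real.pi_ne_zero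
  have h0 : (0 : ℂ) ∉ upperHalf := by simp [upperHalf]
  have heq : Set.EqOn (upperHalf.indicator fun w => X w / Real.pi) (fun w => X w / Real.pi)
      upperHalf := fun w hw => Set.indicator_of_mem hw _
  have hev : (upperHalf.indicator fun w => X w / Real.pi) =ᶠ[𝓝[upperHalf] 0]
      fun w => X w / Real.pi := by
    filter_upwards [self_mem_nhdsWithin] with w hw using heq hw
  have hscale := scaledComb_bijOn hX.two_lt hX.nonneg hX.fixed
  refine ⟨?_, ?_, Set.indicator_of_notMem h0 _, ?_, ?_, ?_⟩
  · refine DifferentiableOn.congr (fun w hw => ?_) heq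
    exact ((hX.differentiableAt hw).div_const _).differentiableWithinAt
  · refine Set.BijOn.congr ⟨fun w hw => ?_, fun v hv w hw h => ?_, fun z hz => ?_⟩ heq.symm
    · rw [mem_combDomain_iff hX.two_lt hX.nonneg hX.fixed, mul_div_cancel₀ _ hpi]
      exact hX.mem_scaledComb hw
    · exact hX.injOn hv hw ((div_left_inj' hpi).1 h)
    · obtain ⟨w, hw, hwX⟩ := hX.bijOn.surjOn (hscale.mapsTo hz)
      refine ⟨w, hw, ?_⟩
      change X w / Real.pi = z
      rw [hwX, mul_div_cancel_left₀ _ hpi]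
  · rw [ContinuousWithinAt, Set.indicator_of_notMem h0]
    have := hX.tendsto_zero.div_const (Real.pi : ℂ)
    rw [zero_div] at this
    exact this.congr' hev.symm
  · have h1 : Tendsto (fun w => X w * (Real.pi : ℂ)⁻¹) (Bornology.cobounded ℂ ⊓ 𝓟 upperHalf)
        (Bornology.cobounded ℂ) :=
      (tendsto_mul_right_cobounded (inv_ne_zero hpi)).comp hX.tendsto_cobounded
    refine h1.congr' ?_
    filter_upwards [mem_inf_of_right (mem_principal_self _)] with w hw
    rw [heq hw]
    exact (div_eq_mul_inv _ _).symm
  · have hd : HasDerivWithinAt (fun w => F w + xi) 1 upperHalf 0 :=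
      (hX.poincare.deriv_zero.add_const _).hasDerivWithinAt
    refine hd.congr (fun w hw => ?_) ?_
    · rw [heq hw, mul_div_cancel₀ _ hpi, hX.cos_eq hw]
    · rw [Set.indicator_of_notMem h0, hX.poincare.map_zero]
      simp

theorem uniqueDiffWithinAt_upperHalf : UniqueDiffWithinAt ℂ upperHalf 0 := by
  have hconv : Convex ℝ upperHalf := convex_halfSpace_im_gt 0
  refine uniqueDiffWithinAt_convex_of_isRCLikeNormedField hconv ?_ ?_
  · rw [isOpen_upperHalf.interior_eq]
    exact ⟨Complex.I, by simp [upperHalf]⟩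
  · have : closure upperHalf = {z : ℂ | 0 ≤ z.im} := Complex.closure_setOfPred_lt_im 0
    rw [this]
    simp

/-- Any normalized comb map differs from `X / π` by an automorphism of the upper half-plane that
fixes `0` and `∞`, hence by a dilation, and the normalization of the derivative excludes all
dilations but the identity. -/
theorem eqOn_of_isNormalizedCombMap (hX : IsCombLift lam xi F r X)
    (hΨ : IsNormalizedCombMap lam xi Ψ) : ∀ w ∈ upperHalf, (Real.pi : ℂ) * Ψ w = X w := by
  have hpi : (Real.pi : ℂ) ≠ 0 := by exact_mod_cast Real.pi_ne_zero
  have hbij : Set.BijOn (fun w => (Real.pi : ℂ) * Ψ w) upperHalf (scaledComb lam xi) :=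
    (scaledComb_bijOn hX.two_lt hX.nonneg hX.fixed).comp hΨ.bijective
  set Y : ℂ → ℂ := fun w => (Real.pi : ℂ) * Ψ w with hY
  set φ : ℂ → ℂ := fun w => Function.invFunOn X upperHalf (Y w) with hφ
  have hφmem : ∀ w ∈ upperHalf, φ w ∈ upperHalf := fun w hw =>
    hX.bijOn.surjOn.mapsTo_invFunOn (hbij.mapsTo hw)
  have hXφ : ∀ w ∈ upperHalf, X (φ w) = Y w := fun w hw =>
    hX.bijOn.surjOn.rightInvOn_invFunOn (hbij.mapsTo hw)
  have hXd : DifferentiableOn ℂ X upperHalf := fun w hw =>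
    (hX.differentiableAt hw).differentiableWithinAt
  have hφd : DifferentiableOn ℂ φ upperHalf := by
    intro w hw
    have h1 : DifferentiableAt ℂ Y w :=
      (hΨ.analytic.differentiableAt (isOpen_upperHalf.mem_nhds hw)).const_mul _
    have h2 := differentiableAt_invFunOn_of_injOn isOpen_upperHalf hXd hX.injOn (hφmem w hw)
    rw [hXφ w hw] at h2
    exact (h2.comp w h1).differentiableWithinAt
  have hφb : Set.BijOn φ upperHalf upperHalf := by
    refine ⟨hφmem, fun v hv w hw h => ?_, fun z hz => ?_⟩
    · apply hbij.injOn hv hw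
      rw [← hXφ v hv, ← hXφ w hw, h]
    · obtain ⟨w, hw, hwY⟩ := hbij.surjOn (hX.mem_scaledComb hz)
      refine ⟨w, hw, hX.injOn (hφmem w hw) hz ?_⟩
      rw [hXφ w hw, hwY]
  have hφinf : Tendsto φ (Bornology.cobounded ℂ ⊓ 𝓟 upperHalf) (Bornology.cobounded ℂ) := by
    have hYinf : Tendsto Y (Bornology.cobounded ℂ ⊓ 𝓟 upperHalf) (Bornology.cobounded ℂ) :=
      (tendsto_mul_left_cobounded hpi).comp hΨ.map_infty
    rw [← tendsto_norm_atTop_iff_cobounded, tendsto_atTop] at hYinf ⊢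
    intro R
    obtain ⟨R', hR'⟩ := hX.exists_norm_le R
    filter_upwards [hYinf (R' + 1), mem_inf_of_right (mem_principal_self _)] with w hw hwH
    by_contra hcon
    push Not at hcon
    have := hR' _ (hφmem w hwH) hcon.le
    rw [hXφ w hwH] at this
    linarith
  have hφ0 : Tendsto φ (𝓝[upperHalf] 0) (𝓝 0) := by
    have hY0 : Tendsto Y (𝓝[upperHalf] 0) (𝓝 0) := by
      have := hΨ.continuous_zero.tendsto.const_mul (Real.pi : ℂ)
      rwa [hΨ.map_zero, mul_zero] at this
    rw [Metric.tendsto_nhds] at hY0 ⊢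
    intro ε hε
    obtain ⟨δ, hδ, h⟩ := hX.exists_norm_lt_of_norm_lt hε
    filter_upwards [hY0 δ hδ, self_mem_nhdsWithin] with w hw hwH
    rw [dist_zero_right] at hw ⊢
    rw [← hXφ w hwH] at hw
    exact h _ (hφmem w hwH) hw
  obtain ⟨a, b, ha, hab⟩ := exists_affine_of_bijOn_upperHalf hφd hφb hφinf
  have hneBot : (𝓝[upperHalf] (0 : ℂ)).NeBot :=
    mem_closure_iff_nhdsWithin_neBot.1 uniqueDiffWithinAt_upperHalf.mem_closure
  have hb0 : (b : ℂ) = 0 := by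
    have h1 : Tendsto (fun w : ℂ => (a : ℂ) * w + b) (𝓝[upperHalf] 0) (𝓝 b) := by
      have hc : Continuous (fun w : ℂ => (a : ℂ) * w + b) := by fun_prop
      have := hc.tendsto 0
      rw [mul_zero, zero_add] at this
      exact this.mono_left nhdsWithin_le_nhds
    refine tendsto_nhds_unique (h1.congr' ?_) hφ0
    filter_upwards [self_mem_nhdsWithin] with w hw using (hab w hw).symm
  have hφa : ∀ w ∈ upperHalf, φ w = a * w := fun w hw => by rw [hab w hw, hb0, add_zero]
  have ha1 : (a : ℂ) = 1 := by
    have hF0 : HasDerivAt F 1 ((a : ℂ) * 0) := by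
      rw [mul_zero]
      exact hX.poincare.deriv_zero
    have hd : HasDerivAt (fun w : ℂ => F (a * w) + xi) a 0 := by
      have h1 : HasDerivAt (fun w : ℂ => (a : ℂ) * w) a 0 := by
        simpa using (hasDerivAt_id' (0 : ℂ)).const_mul (a : ℂ)
      have h2 := (HasDerivAt.comp (0 : ℂ) hF0 h1).add_const (xi : ℂ)
      simpa [Function.comp_def] using h2
    refine uniqueDiffWithinAt_upperHalf.eq_deriv _ hd.hasDerivWithinAt
      (hΨ.deriv_zero.congr (fun w hw => ?_) ?_)
    · have h1 := hX.cos_eq (hφmem w hw)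
      rw [hXφ w hw, hφa w hw] at h1
      exact h1.symm
    · rw [hΨ.map_zero, mul_zero, hX.poincare.map_zero]
      simp
  intro w hw
  change Y w = X w
  rw [← hXφ w hw, hφa w hw, ha1, one_mul]

/-- In a sector the imaginary part of the lift is bounded below on the fundamental annulus
`1 ≤ |w| ≤ 2 ξ`, and each application of `L` doubles it. -/
theorem tendsto_sector (hX : IsCombLift lam xi F r X) {ε : ℝ} (hε : 0 < ε) :
    Tendsto F (Bornology.cobounded ℂ ⊓ 𝓟 {w : ℂ | ε * ‖w‖ ≤ w.im}) (Bornology.cobounded ℂ) := by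
  have h2 := hX.two_lt_xi
  set K : Set ℂ := Metric.closedBall 0 (2 * xi) ∩ ({w : ℂ | 1 ≤ ‖w‖} ∩ {w : ℂ | ε * ‖w‖ ≤ w.im})
    with hK
  have hKc : IsCompact K := (isCompact_closedBall _ _).inter_right
    ((isClosed_le continuous_const continuous_norm).inter
      (isClosed_le (continuous_const.mul continuous_norm) Complex.continuous_im))
  have hKH : ∀ w ∈ K, 0 < w.im := by
    rintro w ⟨-, h1, h3⟩
    have h1' : 1 ≤ ‖w‖ := h1
    have h3' : ε * ‖w‖ ≤ w.im := h3
    nlinarith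
  obtain ⟨c, hc, hcK⟩ : ∃ c : ℝ, 0 < c ∧ ∀ w ∈ K, c ≤ (X w).im := by
    rcases K.eq_empty_or_nonempty with h | h
    · exact ⟨1, one_pos, by simp [h]⟩
    · have hcont : ContinuousOn (fun w => (X w).im) K := fun w hw =>
        (Complex.continuous_im.continuousAt.comp
          (hX.differentiableAt (hKH w hw)).continuousAt).continuousWithinAt
      obtain ⟨w₀, hw₀, hmin⟩ := hKc.exists_isMinOn h hcont
      exact ⟨(X w₀).im, (hX.mem_scaledComb (hKH w₀ hw₀)).2.1, fun w hw => hmin hw⟩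
  rw [← tendsto_norm_atTop_iff_cobounded, tendsto_atTop]
  intro M
  obtain ⟨N, hN⟩ := pow_unbounded_of_one_lt ((M + xi) / (xi * c)) one_lt_two
  have h1 : ∀ᶠ w : ℂ in Bornology.cobounded ℂ, (2 * xi) ^ N < ‖w‖ :=
    tendsto_norm_cobounded_atTop.eventually_gt_atTop _
  filter_upwards [mem_inf_of_left h1, mem_inf_of_right (mem_principal_self _)] with w hw hwS
  have hw' : (2 * xi) ^ N < ‖w‖ := hw
  have hwS' : ε * ‖w‖ ≤ w.im := hwS
  have hw1 : 1 ≤ ‖w‖ := (one_le_pow₀ (by linarith)).trans hw'.le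
  obtain ⟨n, hn1, hn2⟩ := exists_nat_pow_near hw1 (by linarith : 1 < 2 * xi)
  have hNn : N ≤ n := by
    have := (pow_lt_pow_iff_right₀ (by linarith : 1 < 2 * xi)).1 (hw'.trans hn2)
    omega
  have hpos : 0 < (2 * xi) ^ n := by positivity
  have hne : (2 * xi : ℂ) ^ n ≠ 0 := by exact_mod_cast hpos.ne'
  obtain ⟨v, hv⟩ : ∃ v : ℂ, (2 * xi : ℂ) ^ n * v = w :=
    ⟨w / (2 * xi : ℂ) ^ n, mul_div_cancel₀ _ hne⟩
  have hvn := norm_two_mul_pow hX.nonneg n v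
  have hvi := im_two_mul_pow_mul (xi := xi) n v
  rw [hv] at hvn hvi
  have hvK : v ∈ K := by
    refine ⟨?_, ?_, ?_⟩
    · rw [mem_closedBall_zero_iff]
      rw [hvn, pow_succ] at hn2
      exact (lt_of_mul_lt_mul_left hn2 hpos.le).le
    · change 1 ≤ ‖v‖
      rw [hvn] at hn1
      by_contra hcon
      push Not at hcon
      nlinarith
    · change ε * ‖v‖ ≤ v.im
      rw [hvn, hvi] at hwS'
      refine le_of_mul_le_mul_left ?_ hpos
      linarith
  have hvim := hKH v hvK
  have hwim : 0 < w.im := by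
    rw [hvi]
    positivity
  have hXim : 2 ^ N * c ≤ (X w).im := by
    rw [← hv, hX.apply_pow_mul hvim]
    have h3 := two_pow_mul_im_le hX.two_lt hX.nonneg hX.fixed (hX.mem_scaledComb hvim).2.1 n
    refine le_trans ?_ h3
    have : (2 : ℝ) ^ N ≤ 2 ^ n := pow_le_pow_right₀ one_le_two hNn
    exact mul_le_mul this (hcK v hvK) hc.le (by positivity)
  have hcos : (X w).im ≤ ‖Complex.cos (X w)‖ := by
    have hpX := (hX.mem_scaledComb hwim).2.1
    have hs := Real.self_le_sinh_iff.2 hpX.le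
    have hsp := Real.sinh_pos_iff.2 hpX
    refine hs.trans ((sq_le_sq₀ hsp.le (norm_nonneg _)).1 ?_)
    rw [← Complex.normSq_eq_norm_sq, Complex.normSq_apply, Complex.cos_re, Complex.cos_im]
    have e1 := Real.sin_sq_add_cos_sq (X w).re
    have e2 := Real.cosh_sq (X w).im
    have e3 := sq_nonneg (Real.cos (X w).re)
    nlinarith
  have hFw := congrArg norm (hX.cos_eq hwim)
  rw [norm_mul, Complex.norm_real, Real.norm_eq_abs, abs_of_nonneg hX.nonneg] at hFw
  have htri := norm_add_le (F w) (xi : ℂ)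
  rw [Complex.norm_real, Real.norm_eq_abs, abs_of_nonneg hX.nonneg] at htri
  rw [div_lt_iff₀ (by positivity)] at hN
  have : xi * (2 ^ N * c) ≤ xi * ‖Complex.cos (X w)‖ :=
    mul_le_mul_of_nonneg_left (hXim.trans hcos) hX.nonneg
  nlinarith

end IsCombLift

theorem mainTheorem3 (lam xi : ℝ) (hlam : 2 < lam) (hxi : 0 ≤ xi)
    (hfix : quadP lam xi = xi) :
    (∃! F : ℂ → ℂ, IsPoincareFunction lam xi F) ∧
    (∃ Ψ : ℂ → ℂ, IsNormalizedCombMap lam xi Ψ ∧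
      ∀ Ψ' : ℂ → ℂ, IsNormalizedCombMap lam xi Ψ' → Set.EqOn Ψ' Ψ upperHalf) ∧
    (∀ F : ℂ → ℂ, IsPoincareFunction lam xi F →
      (∀ ε : ℝ, 0 < ε →
        Tendsto F (Bornology.cobounded ℂ ⊓ 𝓟 {w : ℂ | ε * ‖w‖ ≤ w.im})
          (Bornology.cobounded ℂ)) ∧
      ∀ Ψ : ℂ → ℂ, IsNormalizedCombMap lam xi Ψ →
        ∀ w ∈ upperHalf,
          F w + (xi : ℂ) = (xi : ℂ) * Complex.cos ((Real.pi : ℂ) * Ψ w)) := by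
  have hlift : ∀ F : ℂ → ℂ, IsPoincareFunction lam xi F → ∃ r X, IsCombLift lam xi F r X := by
    intro F hF
    obtain ⟨r, hr⟩ := hF.exists_radius
    obtain ⟨X, hX⟩ := exists_isCombLift hlam hxi hfix hF hr
    exact ⟨r, X, hX⟩
  obtain ⟨F₀, hF₀⟩ := exists_isPoincareFunction hlam hxi hfix
  refine ⟨⟨F₀, hF₀, fun F hF => hF.eq hlam hxi hfix hF₀⟩, ?_, fun F hF => ?_⟩
  · obtain ⟨r, X, hX⟩ := hlift F₀ hF₀
    refine ⟨_, hX.isNormalizedCombMap, fun Ψ hΨ w hw => ?_⟩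
    have hpi : (Real.pi : ℂ) ≠ 0 := by exact_mod_cast Real.pi_ne_zero
    rw [Set.indicator_of_mem hw, ← hX.eqOn_of_isNormalizedCombMap hΨ w hw,
      mul_div_cancel_left₀ _ hpi]
  · obtain ⟨r, X, hX⟩ := hlift F hF
    refine ⟨fun ε hε => hX.tendsto_sector hε, fun Ψ hΨ w hw => ?_⟩
    rw [hX.eqOn_of_isNormalizedCombMap hΨ w hw, hX.cos_eq hw]
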